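/- **Theorem 7.1.** Let $\mathcal G$ be a locally compact (Hausdorff) group with left Haar measure and Haar module $\Delta$ (normalised by $|Ex|=\Delta(x)|E|$), let $\pi$ be an irreducible (strongly continuous) unitary representation of $\mathcal G$ on a complex Hilbert space $\mathcal H$, and write $V_gf(x)=\langle f,\pi(x)g\rangle$. Write $L_xF(y)=F(x^{-1}y)$, $R_xF(y)=F(yx)$, $F^\vee(x)=F(x^{-1})$, and $A_x\nu(k)=\nu(R_xk)$ for complex Radon measures $\nu$ and $k\in C_c(\mathcal G)$. Fix a measurable relatively compact neighbourhood $Q$ of the identity. For a solid quasi-Banach function space $Y$ on $\mathcal G$ let $W(L^\infty,Y)=\{F: K_F\in Y\}$, $K_F(x)=\operatorname{ess\,sup}_{xQ}|F|$, with $\|F|W(L^\infty,Y)\|=\|K_F|Y\|$, and $W(M,Y)=\{\nu \text{ complex Radon}: x\mapsto|\nu|(xQ)\in Y\}$ with $\|\nu|W(M,Y)\|=\|\,|\nu|(\cdot\, Q)\,|Y\|$; $|||\cdot|||$ denotes operator quasi-norms, and $Y^\vee=\{F:F^\vee\in Y\}$. Put $$w_Y(x)=\max\{|||R_x|W(L^\infty,Y)|||,\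 \Delta(x^{-1})|||R_{x^{-1}}|W(L^\infty,Y)|||\},\quad \tilde w_Y(x)=\max\{w_Y(x),|||A_x|W(M,Y)|||\},$$ $$v_Y(x)=\max\{1,|||L_{x^{-1}}|W(L^\infty,Y)|||\}.$$ If $0<r\le1$ and $Y$ has an equivalent $r$-norm, let $\mathbb D(Y)$ be the set of $g\in\mathcal H$ with $V_gg\in L^1_{v_Y}$, $V_gg\in W(L^\infty,L^r_{\tilde w_Y})$ and $V_gg\in W(L^\infty,W(L^\infty,L^r_{w_Y})^\vee)^\vee$. Let $m>0$ be a measurable weight with $m(xyz)\le w(x)m(y)w(z)$ for some continuous submultiplicative weight $w>0$. Let $0<p<q\le\infty$ and $\alpha=1/p-1/q$. Let $L^q_m=\{F:Fm\in L^q\}$, with $\|F|L^q_m\|=\|Fm\|_{L^q}$, and $L_m(p,\infty)=\{F:\|F|L_m(p,\infty)\|=\sup_{t>0}t^{1/p}(Fm)^*(t)<\infty\}$, where $^*$ denotes the non-increasing rearrangement. Let $0\ne g\in\mathbb D(L_m(p,\infty))$ (with respect to some $r\in(0,1]$ such that $L_m(p,\infty)$ has an equivalent $r$-norm). Let $v=\max\{v_{L_m(p,\infty)},v_{L^q_m}\}$,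 let $\mathcal H^1_v=\{f\in\mathcal H:V_gf\in L^1_v\}$ with norm $\|V_gf|L^1_v\|$, and let $(\mathcal H^1_v)^\urcorner$ be the space of bounded conjugate-linear functionals on it, to which $V_g$ extends. For $Y\in\{L_m(p,\infty),L^q_m\}$ let $\mathcal C(Y)=\{f\in(\mathcal H^1_v)^\urcorner:V_gf\in W(L^\infty,Y)\}$ with $\|f|\mathcal C(Y)\|=\|V_gf|W(L^\infty,Y)\|$. Let $(x_i)_{i\in I}$ be a well-spread family in $\mathcal G$: it is relatively separated, i.e. $\sup_j\#\{i:x_iK\cap x_jK\ne\emptyset\}<\infty$ for every compact $K$, and $\mathcal G=\bigcup_i x_iV$ for some relatively compact neighbourhood $V$ of the identity. Let $Y_d$ be the space of sequences with $\|(\lambda_i)|Y_d\|=\|\sum_i|\lambda_i|\chi_{x_iQ}|Y\|<\infty$. Suppose that $\{\pi(x_i)g\}_{i\in I}$ is an atomic decomposition of $\mathcal C(Y)$ both for $Y=L_m(p,\infty)$ and for $Y=L^q_m$. This means that there are bounded linear functionals $\lambda_i$ on $(\mathcal H^1_v)^\urcorner$ such that (a) $f=\sum_i\lambda_i(f)\pi(x_i)g$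 for all $f\in\mathcal C(Y)$, with weak-$*$ convergence in $(\mathcal H^1_v)^\urcorner$, and with convergence in $\mathcal C(Y)$ if the finite sequences are dense in $Y_d$; (b) $f\in(\mathcal H^1_v)^\urcorner$ belongs to $\mathcal C(Y)$ if and only if $(\lambda_i(f))_i\in Y_d$, and $\|(\lambda_i(f))_i|Y_d\|\asymp\|f|\mathcal C(Y)\|$ on $\mathcal C(Y)$. Then there is a constant $C$ such that for all $f\in\mathcal C(L_m(p,\infty))$ and all integers $n\ge1$ $$\sigma_n(f,\mathcal C(L^q_m)):=\inf_{N\subset I,\ \#N\le n,\ (c_i)\in\mathbb C^N}\Big\|f-\sum_{i\in N}c_i\pi(x_i)g\,\Big|\,\mathcal C(L^q_m)\Big\|\le C\,\|f|\mathcal C(L_m(p,\infty))\|\,n^{-\alpha}.$$ -/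

import Mathlib

open MeasureTheory Filter Topology
open scoped ENNReal NNReal Pointwise ComplexConjugate

namespace Coorbit

/-! ## Function spaces on the group

A solid quasi-normed space `Y` of measurable functions on `G` is given by its quasi-norm on moduli,
`N : (G → ℝ≥0∞) → ℝ≥0∞`, through `‖F | Y‖ = N |F|` and `F ∈ Y ↔ N |F| < ∞`. -/

section FunctionSpaces

variable {G : Type*} [MeasurableSpace G]

/-- The distribution function `s ↦ |{x : F x > s}|`. -/
noncomputable def distribution (μ : Measure G) (F : G → ℝ≥0∞) (s : ℝ≥0∞) : ℝ≥0∞ :=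
  μ {x | s < F x}

/-- The non-increasing rearrangement `F*(t) = inf {s : λ_F(s) ≤ t}`. -/
noncomputable def rearrangement (μ : Measure G) (F : G → ℝ≥0∞) (t : ℝ≥0∞) : ℝ≥0∞ :=
  sInf {s | distribution μ F s ≤ t}

/-- The quasi-norm of the weighted Lorentz space `L_m(p, ∞)` (weak `L^p`):
`sup_{t > 0} t^{1/p} (F m)*(t)`. -/
noncomputable def weakLp (μ : Measure G) (m : G → ℝ≥0∞) (p : ℝ) (F : G → ℝ≥0∞) : ℝ≥0∞ :=
  ⨆ (t : ℝ≥0) (_ : 0 < t), (t : ℝ≥0∞) ^ (1 / p) * rearrangement μ (fun x => F x * m x) t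

/-- The quasi-norm `‖F m | L^q‖` of the weighted Lebesgue space `L^q_m`, `0 < q ≤ ∞`. -/
noncomputable def weightedLp (μ : Measure G) (m : G → ℝ≥0∞) (q : ℝ≥0∞) (F : G → ℝ≥0∞) : ℝ≥0∞ :=
  eLpNorm (fun x => F x * m x) q μ

/-- `‖F | L^1_v‖ = ∫ |F| v dμ`, written as the integral of `|F|` against the measure `v dμ`. -/
noncomputable def weightedL1 (μ : Measure G) (v : G → ℝ≥0∞) (F : G → ℂ) : ℝ≥0∞ :=
  ∫⁻ x, ‖F x‖ₑ ∂(μ.withDensity v)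

/-- The space with quasi-norm `N` has an `r`-norm (`0 < r ≤ 1`): some equivalent quasi-norm
satisfies the `r`-triangle inequality. -/
def HasRNorm (N : (G → ℝ≥0∞) → ℝ≥0∞) (r : ℝ) : Prop :=
  0 < r ∧ r ≤ 1 ∧ ∃ N' : (G → ℝ≥0∞) → ℝ≥0∞,
    (∃ c C : ℝ≥0, 0 < c ∧ ∀ F, c * N F ≤ N' F ∧ N' F ≤ C * N F) ∧
    (∀ (a : ℝ≥0) (F : G → ℝ≥0∞), N' (fun x => a * F x) = a * N' F) ∧
    ∀ F₁ F₂ : G → ℝ≥0∞, Measurable F₁ → Measurable F₂ →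
      N' (fun x => F₁ x + F₂ x) ^ r ≤ N' F₁ ^ r + N' F₂ ^ r

end FunctionSpaces

/-! ## Weights and point sets -/

section Weights

variable {G : Type*} [Group G] [TopologicalSpace G]

/-- A (continuous, positive) submultiplicative weight. -/
def IsSubmultiplicativeWeight (w : G → ℝ) : Prop :=
  Continuous w ∧ (∀ x, 0 < w x) ∧ ∀ x y, w (x * y) ≤ w x * w y

/-- A (measurable, positive) `w`-moderate weight. -/
def IsModerateWeight [MeasurableSpace G] (w m : G → ℝ) : Prop :=
  Measurable m ∧ (∀ x, 0 < m x) ∧ ∀ x y z, m (x * y * z) ≤ w x * m y * w z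

/-- Relatively compact neighbourhoods of the identity. -/
def IsRelCompactNhd (V : Set G) : Prop :=
  V ∈ 𝓝 (1 : G) ∧ IsCompact (closure V)

/-- Relatively separated families: `sup_j #{i : x_i K ∩ x_j K ≠ ∅} < ∞` for all compact `K`. -/
def IsRelativelySeparated {I : Type*} (X : I → G) : Prop :=
  ∀ K : Set G, IsCompact K → ∃ C : ℕ, ∀ j, {i | ((X i • K) ∩ (X j • K)).Nonempty}.encard ≤ C

/-- Well-spread families: relatively separated and `V`-dense for some relatively compact
neighbourhood `V` of the identity. -/
def IsWellSpread {I : Type*} (X : I → G) : Prop :=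
  IsRelativelySeparated X ∧ ∃ V : Set G, IsRelCompactNhd V ∧ ⋃ i, X i • V = Set.univ

end Weights

/-! ## Wiener amalgam spaces -/

section Amalgam

/-- The operator quasi-norm of `T` on the quasi-normed space with elements `B` and quasi-norm `ρ`
(it is `∞` if `T` is not bounded). -/
noncomputable def opNorm {E : Type*} (B : Set E) (ρ : E → ℝ≥0∞) (T : E → E) : ℝ≥0∞ :=
  ⨅ (C : ℝ≥0) (_ : ∀ F ∈ B, ρ (T F) ≤ C * ρ F), (C : ℝ≥0∞)

variable {G : Type*} [Group G]

/-- Left translation `L_x F (y) = F (x⁻¹ y)`. -/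
def leftTranslate (x : G) (F : G → ℂ) : G → ℂ := fun y => F (x⁻¹ * y)

/-- Right translation `R_x F (y) = F (y x)`. -/
def rightTranslate (x : G) (F : G → ℂ) : G → ℂ := fun y => F (y * x)

variable [MeasurableSpace G]

/-- The control function `K(F, Q, L^∞)(x) = ess sup_{xQ} |F|` (for a modulus `F`). -/
noncomputable def control (μ : Measure G) (Q : Set G) (F : G → ℝ≥0∞) : G → ℝ≥0∞ :=
  fun x => essSup F (μ.restrict (x • Q))

/-- The quasi-norm of `W(L^∞, Y, Q)`, again as a functional on moduli. -/
noncomputable def amalgam (μ : Measure G) (Q : Set G) (N : (G → ℝ≥0∞) → ℝ≥0∞) :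
    (G → ℝ≥0∞) → ℝ≥0∞ :=
  fun F => N (control μ Q F)

/-- The quasi-norm of `Y^∨ = {F : F^∨ ∈ Y}` with `F^∨(x) = F(x⁻¹)`. -/
def vee (N : (G → ℝ≥0∞) → ℝ≥0∞) : (G → ℝ≥0∞) → ℝ≥0∞ :=
  fun F => N (fun x => F x⁻¹)

/-- `‖F | W(L^∞, Y, Q)‖` for a complex function. -/
noncomputable def amalgamNorm (μ : Measure G) (Q : Set G) (N : (G → ℝ≥0∞) → ℝ≥0∞) (F : G → ℂ) :
    ℝ≥0∞ :=
  amalgam μ Q N (fun x => ‖F x‖ₑ)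

/-- The space `W(L^∞, Y, Q)`. -/
def amalgamSpace (μ : Measure G) (Q : Set G) (N : (G → ℝ≥0∞) → ℝ≥0∞) : Set (G → ℂ) :=
  {F | AEStronglyMeasurable F μ ∧ amalgamNorm μ Q N F < ∞}

/-- The quasi-norm of the sequence space `Y_d(X, Q)`: `‖∑ᵢ |λᵢ| χ_{xᵢ Q} | Y‖`. -/
noncomputable def seqNorm {I : Type*} (N : (G → ℝ≥0∞) → ℝ≥0∞) (Q : Set G) (X : I → G)
    (c : I → ℂ) : ℝ≥0∞ :=
  N (fun y => ∑' i, (X i • Q).indicator (fun _ => ‖c i‖ₑ) y)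

/-- The finite sequences are dense in `Y_d(X, Q)`. -/
def FiniteSequencesDense {I : Type*} (N : (G → ℝ≥0∞) → ℝ≥0∞) (Q : Set G) (X : I → G) : Prop :=
  ∀ c : I → ℂ, seqNorm N Q X c < ∞ → ∀ ε : ℝ≥0∞, 0 < ε →
    ∃ d : I → ℂ, (Function.support d).Finite ∧ seqNorm N Q X (c - d) < ε

end Amalgam

section Radon

/-- A complex Radon measure on `G` (possibly of infinite total mass), in its polar decomposition
`dν = phase d|ν|` with `|phase| = 1` and total variation `|ν|` a positive Radon measure. -/
structure ComplexRadon (G : Type*) [TopologicalSpace G] [MeasurableSpace G] where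
  /-- the total variation `|ν|` -/
  variation : Measure G
  /-- the density of `ν` with respect to `|ν|` -/
  phase : G → ℂ
  regular : variation.Regular
  measurable_phase : Measurable phase
  norm_phase : ∀ x, ‖phase x‖ = 1

variable {G : Type*} [Group G] [TopologicalSpace G] [IsTopologicalGroup G]
  [MeasurableSpace G] [BorelSpace G]

/-- `A_x ν (k) = ν (R_x k)` for `k ∈ C_c(G)`, that is, the image of `ν` under `y ↦ y x`. -/
noncomputable def ComplexRadon.translate (x : G) (ν : ComplexRadon G) : ComplexRadon G where
  variation := ν.variation.map (fun y => y * x)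
  phase := fun y => ν.phase (y * x⁻¹)
  regular := by
    have := ν.regular
    exact Measure.Regular.map (Homeomorph.mulRight x)
  measurable_phase := ν.measurable_phase.comp (continuous_mul_const x⁻¹).measurable
  norm_phase := fun _ => ν.norm_phase _

/-- `‖ν | W(M, Y, Q)‖`, with control function `K(ν, Q, M)(x) = |ν|(xQ)`. -/
noncomputable def radonNorm (Q : Set G) (N : (G → ℝ≥0∞) → ℝ≥0∞) (ν : ComplexRadon G) : ℝ≥0∞ :=
  N (fun x => ν.variation (x • Q))

/-- The space `W(M, Y, Q)`. -/
def radonSpace (Q : Set G) (N : (G → ℝ≥0∞) → ℝ≥0∞) : Set (ComplexRadon G) :=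
  {ν | radonNorm Q N ν < ∞}

/-! ## The weights attached to a function space `Y` -/

/-- The Haar module `Δ`, normalised by `|E x| = Δ(x) |E|` for the left Haar measure.
(Mathlib's modular function is normalised by `|E x⁻¹| = Δ(x) |E|`.) -/
noncomputable def haarModule [LocallyCompactSpace G] (x : G) : ℝ≥0 :=
  Measure.modularCharacterFun x⁻¹

/-- `|||R_x | W(L^∞, Y)|||`. -/
noncomputable def rightNorm (μ : Measure G) (Q : Set G) (N : (G → ℝ≥0∞) → ℝ≥0∞) (x : G) : ℝ≥0∞ :=
  opNorm (amalgamSpace μ Q N) (amalgamNorm μ Q N) (rightTranslate x)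

/-- `|||L_x | W(L^∞, Y)|||`. -/
noncomputable def leftNorm (μ : Measure G) (Q : Set G) (N : (G → ℝ≥0∞) → ℝ≥0∞) (x : G) : ℝ≥0∞ :=
  opNorm (amalgamSpace μ Q N) (amalgamNorm μ Q N) (leftTranslate x)

/-- `|||A_x | W(M, Y)|||`. -/
noncomputable def radonTranslateNorm (Q : Set G) (N : (G → ℝ≥0∞) → ℝ≥0∞) (x : G) : ℝ≥0∞ :=
  opNorm (radonSpace Q N) (radonNorm Q N) (ComplexRadon.translate x)

/-- `w(x) = max {|||R_x | W(L^∞, Y)|||, Δ(x⁻¹) |||R_{x⁻¹} | W(L^∞, Y)|||}`. -/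
noncomputable def weightW [LocallyCompactSpace G] (μ : Measure G) (Q : Set G)
    (N : (G → ℝ≥0∞) → ℝ≥0∞) (x : G) : ℝ≥0∞ :=
  max (rightNorm μ Q N x) (haarModule x⁻¹ * rightNorm μ Q N x⁻¹)

/-- `w̃(x) = max {w(x), |||A_x | W(M, Y)|||}`. -/
noncomputable def weightWTilde [LocallyCompactSpace G] (μ : Measure G) (Q : Set G)
    (N : (G → ℝ≥0∞) → ℝ≥0∞) (x : G) : ℝ≥0∞ :=
  max (weightW μ Q N x) (radonTranslateNorm Q N x)

/-- `v(x) = max {1, |||L_{x⁻¹} | W(L^∞, Y)|||}`. -/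
noncomputable def weightV (μ : Measure G) (Q : Set G) (N : (G → ℝ≥0∞) → ℝ≥0∞) (x : G) : ℝ≥0∞ :=
  max 1 (leftNorm μ Q N x⁻¹)

end Radon

/-! ## Representations, voice transform, coorbit spaces -/

/-- Irreducible (strongly continuous) unitary representations of `G` on `H`. -/
structure IrredUnitaryRep (G H : Type*) [Group G] [TopologicalSpace G] [NormedAddCommGroup H]
    [InnerProductSpace ℂ H] where
  /-- the underlying homomorphism into the unitary operators -/
  toHom : G →* (H ≃ₗᵢ[ℂ] H)
  continuous_orbit : ∀ h : H, Continuous fun x => toHom x h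
  nontrivial : Nontrivial H
  irreducible : ∀ S : Submodule ℂ H, IsClosed (S : Set H) →
    (∀ x, ∀ h ∈ S, toHom x h ∈ S) → S = ⊥ ∨ S = ⊤

section Coorbit

variable {G : Type*} [Group G] [TopologicalSpace G]
  {H : Type*} [NormedAddCommGroup H] [InnerProductSpace ℂ H]

/-- The voice transform `V_g f(x) = ⟨f, π(x) g⟩` on `H` (linear in `f`). -/
noncomputable def voice (π : IrredUnitaryRep G H) (g f : H) (x : G) : ℂ :=
  inner ℂ (π.toHom x g) f

theorem continuous_voice (π : IrredUnitaryRep G H) (g f : H) : Continuous (voice π g f) :=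
  (π.continuous_orbit g).inner continuous_const

variable [MeasurableSpace G] [BorelSpace G]

/-- The space `H^1_v = {f ∈ H : V_g f ∈ L^1_v}`. -/
noncomputable def H1 (μ : Measure G) (π : IrredUnitaryRep G H) (g : H) (v : G → ℝ≥0∞) :
    Submodule ℂ H where
  carrier := {f | weightedL1 μ v (voice π g f) < ∞}
  zero_mem' := by simp [weightedL1, voice]
  add_mem' := by
    intro a b ha hb
    have hm : Measurable fun x => ‖voice π g a x‖ₑ := (continuous_voice π g a).enorm.measurable
    calc weightedL1 μ v (voice π g (a + b))
        ≤ ∫⁻ x, (‖voice π g a x‖ₑ + ‖voice π g b x‖ₑ) ∂(μ.withDensity v) := by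
          refine lintegral_mono fun x => ?_
          simp only [voice, inner_add_right]
          exact enorm_add_le _ _
      _ = weightedL1 μ v (voice π g a) + weightedL1 μ v (voice π g b) :=
          lintegral_add_left hm _
      _ < ∞ := ENNReal.add_lt_top.2 ⟨ha, hb⟩
  smul_mem' := by
    intro c a ha
    have hm : Measurable fun x => ‖voice π g a x‖ₑ := (continuous_voice π g a).enorm.measurable
    have : weightedL1 μ v (voice π g (c • a)) = ‖c‖ₑ * weightedL1 μ v (voice π g a) := by
      unfold weightedL1
      rw [← lintegral_const_mul _ hm]
      refine lintegral_congr fun x => ?_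
      simp [voice, enorm_mul]
    change weightedL1 μ v (voice π g (c • a)) < ∞
    rw [this]
    exact ENNReal.mul_lt_top enorm_lt_top ha

/-- The norm `‖h | H^1_v‖ = ‖V_g h | L^1_v‖`. -/
noncomputable def h1Norm (μ : Measure G) (π : IrredUnitaryRep G H) (g : H) (v : G → ℝ≥0∞)
    (h : H1 μ π g v) : ℝ :=
  (weightedL1 μ v (voice π g h)).toReal

/-- All conjugate-linear functionals on `H^1_v`. -/
abbrev ConjFunctional (μ : Measure G) (π : IrredUnitaryRep G H) (g : H) (v : G → ℝ≥0∞) : Type _ :=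
  H1 μ π g v →ₛₗ[starRingEnd ℂ] ℂ

/-- The reservoir: the anti-dual of `H^1_v`, that is, the bounded conjugate-linear functionals. -/
def antiDual (μ : Measure G) (π : IrredUnitaryRep G H) (g : H) (v : G → ℝ≥0∞) :
    Submodule ℂ (ConjFunctional μ π g v) where
  carrier := {f | ∃ B : ℝ, 0 ≤ B ∧ ∀ h, ‖f h‖ ≤ B * h1Norm μ π g v h}
  zero_mem' := ⟨0, le_rfl, fun h => by simp⟩
  add_mem' := by
    rintro a b ⟨A, hA, ha⟩ ⟨B, hB, hb⟩
    refine ⟨A + B, add_nonneg hA hB, fun h => ?_⟩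
    rw [add_mul]
    exact (norm_add_le _ _).trans (add_le_add (ha h) (hb h))
  smul_mem' := by
    rintro c a ⟨A, hA, ha⟩
    refine ⟨‖c‖ * A, mul_nonneg (norm_nonneg _) hA, fun h => ?_⟩
    rw [LinearMap.smul_apply, norm_smul, mul_assoc]
    exact mul_le_mul_of_nonneg_left (ha h) (norm_nonneg _)

/-- The norm of the anti-dual of `H^1_v`. -/
noncomputable def antiDualNorm {μ : Measure G} {π : IrredUnitaryRep G H} {g : H} {v : G → ℝ≥0∞}
    (f : ConjFunctional μ π g v) : ℝ :=
  sInf {B : ℝ | 0 ≤ B ∧ ∀ h, ‖f h‖ ≤ B * h1Norm μ π g v h}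

/-- The embedding `u ↦ ⟨u, ·⟩` of `H` into the conjugate-linear functionals on `H^1_v`. -/
noncomputable def ofHilbert (μ : Measure G) (π : IrredUnitaryRep G H) (g : H) (v : G → ℝ≥0∞)
    (u : H) : ConjFunctional μ π g v where
  toFun := fun h => inner ℂ (h : H) u
  map_add' := fun a b => by simp
  map_smul' := fun c a => by simp [mul_comm]

open Classical in
/-- The extended voice transform `V_g f(x) = ⟨f, π(x) g⟩`. (If `V_g g ∈ L^1_v` and `v` is
submultiplicative and finite, then `π(x) g ∈ H^1_v` for every `x`.) -/
noncomputable def extVoice {μ : Measure G} {π : IrredUnitaryRep G H} {g : H} {v : G → ℝ≥0∞}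
    (f : ConjFunctional μ π g v) (x : G) : ℂ :=
  if hx : π.toHom x g ∈ H1 μ π g v then f ⟨π.toHom x g, hx⟩ else 0

/-- `‖f | 𝒞(Y)‖ = ‖V_g f | W(L^∞, Y)‖`. -/
noncomputable def coorbitNorm {μ : Measure G} {π : IrredUnitaryRep G H} {g : H} {v : G → ℝ≥0∞}
    (Q : Set G) (N : (G → ℝ≥0∞) → ℝ≥0∞) (f : ConjFunctional μ π g v) : ℝ≥0∞ :=
  amalgamNorm μ Q N (extVoice f)

/-- The coorbit space `𝒞(Y)`: those `f` in the anti-dual of `H^1_v` with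
`V_g f ∈ W(L^∞, Y)`. -/
def coorbit (μ : Measure G) (π : IrredUnitaryRep G H) (g : H) (v : G → ℝ≥0∞)
    (Q : Set G) (N : (G → ℝ≥0∞) → ℝ≥0∞) : Set (ConjFunctional μ π g v) :=
  {f | f ∈ antiDual μ π g v ∧ extVoice f ∈ amalgamSpace μ Q N}

/-- The class `𝔻(Y)` of analysing vectors, where `Y` has an `r`-norm:
`V_g g ∈ L^1_v`, `V_g g ∈ W(L^∞, L^r_w̃)` and `V_g g ∈ W(L^∞, W(L^∞, L^r_w)^∨)^∨`. -/
def analyzingVectors [IsTopologicalGroup G] [LocallyCompactSpace G] (μ : Measure G)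
    (π : IrredUnitaryRep G H) (Q : Set G) (N : (G → ℝ≥0∞) → ℝ≥0∞) (r : ℝ) : Set H :=
  {g | weightedL1 μ (weightV μ Q N) (voice π g g) < ∞ ∧
    amalgam μ Q (weightedLp μ (weightWTilde μ Q N) (ENNReal.ofReal r))
      (fun x => ‖voice π g g x‖ₑ) < ∞ ∧
    vee (amalgam μ Q (vee (amalgam μ Q (weightedLp μ (weightW μ Q N) (ENNReal.ofReal r)))))
      (fun x => ‖voice π g g x‖ₑ) < ∞}

/-- `{π(x_i) g}` is an atomic decomposition of `𝒞(Y)`. -/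
def IsAtomicDecomposition (μ : Measure G) (π : IrredUnitaryRep G H) (g : H) (v : G → ℝ≥0∞)
    (Q : Set G) (N : (G → ℝ≥0∞) → ℝ≥0∞) {I : Type*} (X : I → G) : Prop :=
  ∃ l : I → (antiDual μ π g v →ₗ[ℂ] ℂ),
    -- each `l i` is bounded on the anti-dual
    (∀ i, ∃ C : ℝ, ∀ f : antiDual μ π g v, ‖l i f‖ ≤ C * antiDualNorm f.1) ∧
    -- expansion with weak-* convergence
    (∀ f : antiDual μ π g v, f.1 ∈ coorbit μ π g v Q N → ∀ h : H1 μ π g v,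
      HasSum (fun i => l i f * ofHilbert μ π g v (π.toHom (X i) g) h) (f.1 h)) ∧
    -- quasi-norm convergence if the finite sequences are dense
    (FiniteSequencesDense N Q X → ∀ f : antiDual μ π g v, f.1 ∈ coorbit μ π g v Q N →
      Tendsto (fun s : Finset I => coorbitNorm Q N
        (f.1 - ∑ i ∈ s, l i f • ofHilbert μ π g v (π.toHom (X i) g))) atTop (𝓝 0)) ∧
    -- characterization of the space by the coefficients
    (∀ f : antiDual μ π g v,
      f.1 ∈ coorbit μ π g v Q N ↔ seqNorm N Q X (fun i => l i f) < ∞) ∧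
    -- equivalence of quasi-norms
    ∃ c C : ℝ≥0, 0 < c ∧ ∀ f : antiDual μ π g v, f.1 ∈ coorbit μ π g v Q N →
      c * seqNorm N Q X (fun i => l i f) ≤ coorbitNorm Q N f.1 ∧
      coorbitNorm Q N f.1 ≤ C * seqNorm N Q X (fun i => l i f)

/-- The error `σ_n(f, 𝒞(Y))` of best `n`-term approximation by elements of `{π(x_i) g}`. -/
noncomputable def bestNTermError {μ : Measure G} {π : IrredUnitaryRep G H} {g : H}
    {v : G → ℝ≥0∞} (Q : Set G) (N : (G → ℝ≥0∞) → ℝ≥0∞) {I : Type*} (X : I → G) (n : ℕ)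
    (f : ConjFunctional μ π g v) : ℝ≥0∞ :=
  ⨅ (s : Finset I) (_ : s.card ≤ n) (c : I → ℂ),
    coorbitNorm Q N (f - ∑ i ∈ s, c i • ofHilbert μ π g v (π.toHom (X i) g))

end Coorbit

end Coorbit

open Coorbit

namespace Coorbit

theorem tsum_rpow_le {J : Type*} (a : J → ℝ≥0∞) {s : ℝ} (hs : 0 < s) (hs1 : s ≤ 1) :
    (∑' k, a k) ^ s ≤ ∑' k, a k ^ s := by
  have hfin : ∀ t : Finset J, (∑ k ∈ t, a k) ^ s ≤ ∑ k ∈ t, a k ^ s := fun t =>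
    Finset.le_sum_of_subadditive (fun x : ℝ≥0∞ => x ^ s) (by simp [hs])
      (fun x y => ENNReal.rpow_add_le_add_rpow x y hs.le hs1) t a
  have hcont := (ENNReal.continuous_rpow_const (y := s)).tendsto (∑' k, a k)
  refine le_of_tendsto (hcont.comp ENNReal.summable.hasSum) (Eventually.of_forall fun t => ?_)
  exact (hfin t).trans (ENNReal.sum_le_tsum t)

theorem tsum_rpow_le_rpow_tsum {J : Type*} (a : J → ℝ≥0∞) {s t : ℝ} (hs : 0 < s) (hst : s ≤ t) :
    ∑' k, a k ^ t ≤ (∑' k, a k ^ s) ^ (t / s) := by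
  have ht : 0 < t := hs.trans_le hst
  have h := tsum_rpow_le (fun k => a k ^ t) (div_pos hs ht) ((div_le_one ht).2 hst)
  have h2 := ENNReal.rpow_le_rpow h (div_pos ht hs).le
  rw [← ENNReal.rpow_mul, div_mul_div_cancel₀ ht.ne', div_self hs.ne', ENNReal.rpow_one] at h2
  refine h2.trans_eq ?_
  congr 1
  refine tsum_congr fun k => ?_
  rw [← ENNReal.rpow_mul, mul_div_cancel₀ _ ht.ne']

section Lp

variable {α : Type*} [MeasurableSpace α] {μ : Measure α}

theorem eLpNorm_tsum_le {J : Type*} [Countable J] {g : J → α → ℝ≥0∞} (hg : ∀ k, Measurable (g k))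
    {q : ℝ≥0∞} (hq : 1 ≤ q) :
    eLpNorm (fun x => ∑' k, g k x) q μ ≤ ∑' k, eLpNorm (g k) q μ := by
  rcases eq_or_ne q ∞ with rfl | hqt
  · simp only [eLpNorm_exponent_top]
    refine essSup_le_of_ae_le _ ?_
    have : ∀ᵐ x ∂μ, ∀ k, ‖g k x‖ₑ ≤ eLpNormEssSup (g k) μ :=
      ae_all_iff.2 fun k => ENNReal.ae_le_essSup _
    filter_upwards [this] with x hx
    exact ENNReal.tsum_le_tsum hx
  · have hq0 : q ≠ 0 := (zero_lt_one.trans_le hq).ne'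
    have hfin : ∀ s : Finset J, eLpNorm (fun x => ∑ k ∈ s, g k x) q μ ≤ ∑ k ∈ s, eLpNorm (g k) q μ := by
      classical
      intro s
      induction s using Finset.induction_on with
      | empty => simp
      | insert a s ha ih =>
        simp only [Finset.sum_insert ha]
        refine (eLpNorm_add_le (hg a).aestronglyMeasurable
          (Finset.measurable_fun_sum s fun k _ => hg k).aestronglyMeasurable hq).trans ?_
        gcongr
    have hqr : 0 < q.toReal := ENNReal.toReal_pos hq0 hqt
    have key : ∫⁻ x, (∑' k, g k x) ^ q.toReal ∂μ
        = ⨆ s : Finset J, ∫⁻ x, (∑ k ∈ s, g k x) ^ q.toReal ∂μ := by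
      rw [← lintegral_iSup_directed]
      · refine lintegral_congr fun x => ?_
        rw [ENNReal.tsum_eq_iSup_sum]
        exact (ENNReal.monotone_rpow_of_nonneg hqr.le).map_iSup_of_continuousAt
          ENNReal.continuous_rpow_const.continuousAt (by simp [hqr])
      · exact fun s =>
          ((Finset.measurable_fun_sum s fun k _ => hg k).pow_const _).aemeasurable
      · refine Monotone.directed_le fun s t hst x => ?_
        exact ENNReal.rpow_le_rpow (Finset.sum_le_sum_of_subset hst) hqr.le
    rw [eLpNorm_eq_lintegral_rpow_enorm_toReal hq0 hqt]
    simp only [enorm_eq_self]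
    rw [key, one_div, ENNReal.rpow_inv_le_iff hqr]
    refine iSup_le fun s => ?_
    rw [← ENNReal.rpow_inv_le_iff hqr]
    have := (hfin s).trans (ENNReal.sum_le_tsum s)
    rw [eLpNorm_eq_lintegral_rpow_enorm_toReal hq0 hqt] at this
    simpa using this

/-- A common form of the triangle inequality in `L^q` for `1 ≤ q` and of the `q`-triangle
inequality for `q < 1`. -/
theorem eLpNorm_tsum_le_of_forall_le {J : Type*} [Countable J] {g : J → α → ℝ≥0∞}
    (hg : ∀ k, Measurable (g k)) {q : ℝ≥0∞} {s : ℝ} (hs : 0 < s) (hs1 : s ≤ 1)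
    (hsq : ENNReal.ofReal s ≤ q) {γ : J → ℝ≥0∞} {B : ℝ≥0∞}
    (hB : ∀ k, eLpNorm (g k) q μ ≤ γ k * B) :
    eLpNorm (fun x => ∑' k, g k x) q μ ≤ (∑' k, γ k ^ s) ^ (1 / s) * B := by
  rcases le_or_gt 1 q with hq | hq
  · refine (eLpNorm_tsum_le hg hq).trans ((ENNReal.tsum_le_tsum hB).trans ?_)
    rw [ENNReal.tsum_mul_right]
    gcongr
    simpa using tsum_rpow_le_rpow_tsum γ hs hs1
  · have hqt : q ≠ ∞ := (hq.trans ENNReal.one_lt_top).ne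
    have hq0 : q ≠ 0 := ((ENNReal.ofReal_pos.2 hs).trans_le hsq).ne'
    have hqr : 0 < q.toReal := ENNReal.toReal_pos hq0 hqt
    have hq1 : q.toReal ≤ 1 := by
      simpa using ENNReal.toReal_mono ENNReal.one_ne_top hq.le
    have hsr : s ≤ q.toReal := (ENNReal.ofReal_le_iff_le_toReal hqt).1 hsq
    have hk : ∀ k, ∫⁻ x, g k x ^ q.toReal ∂μ ≤ γ k ^ q.toReal * B ^ q.toReal := fun k => by
      have := hB k
      rw [eLpNorm_eq_lintegral_rpow_enorm_toReal hq0 hqt, one_div,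
        ENNReal.rpow_inv_le_iff hqr, ENNReal.mul_rpow_of_nonneg _ _ hqr.le] at this
      simpa using this
    rw [eLpNorm_eq_lintegral_rpow_enorm_toReal hq0 hqt, one_div,
        ENNReal.rpow_inv_le_iff hqr, ENNReal.mul_rpow_of_nonneg _ _ hqr.le]
    simp only [enorm_eq_self]
    calc ∫⁻ x, (∑' k, g k x) ^ q.toReal ∂μ
        ≤ ∫⁻ x, ∑' k, g k x ^ q.toReal ∂μ := lintegral_mono fun x => tsum_rpow_le _ hqr hq1
      _ = ∑' k, ∫⁻ x, g k x ^ q.toReal ∂μ :=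
          lintegral_tsum fun k => ((hg k).pow_const _).aemeasurable
      _ ≤ ∑' k, γ k ^ q.toReal * B ^ q.toReal := ENNReal.tsum_le_tsum hk
      _ = (∑' k, γ k ^ q.toReal) * B ^ q.toReal := ENNReal.tsum_mul_right
      _ ≤ _ := by
          gcongr
          refine (tsum_rpow_le_rpow_tsum γ hs hsr).trans_eq ?_
          rw [← ENNReal.rpow_mul]
          congr 1
          ring

/-- The constant in `lintegral_rpow_le_of_weak_type`. -/
noncomputable def weakTypeConst (p q : ℝ) : ℝ≥0∞ :=
  2 ^ q * ∑' j : ℕ, ((2⁻¹ : ℝ≥0∞) ^ (q - p)) ^ (j + 1)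

theorem weakTypeConst_ne_top {p q : ℝ} (hp : 0 < p) (hpq : p < q) : weakTypeConst p q ≠ ∞ := by
  have h1 : ((2⁻¹ : ℝ≥0∞) ^ (q - p)) < 1 :=
    ENNReal.rpow_lt_one (by simp) (sub_pos.2 hpq)
  unfold weakTypeConst
  rw [ENNReal.tsum_geometric_add_one]
  refine ENNReal.mul_ne_top (ENNReal.rpow_ne_top_of_nonneg (hp.trans hpq).le (by simp))
    (ENNReal.mul_ne_top h1.ne_top ?_)
  simpa [tsub_eq_zero_iff_le] using h1

theorem lintegral_rpow_le_of_weak_type {f : α → ℝ≥0∞} (hf : Measurable f) {p q : ℝ}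
    (hp : 0 < p) (hpq : p < q) {A M : ℝ≥0∞} (hM0 : M ≠ 0) (hM : M ≠ ∞)
    (hA : ∀ s : ℝ≥0∞, s * μ {x | s < f x} ^ (1 / p) ≤ A) (hfM : ∀ x, f x ≤ M) :
    ∫⁻ x, f x ^ q ∂μ ≤ weakTypeConst p q * (A ^ p * M ^ (q - p)) := by
  have hq : 0 < q := hp.trans hpq
  set S : ℕ → ℝ≥0∞ := fun j => (2⁻¹ : ℝ≥0∞) ^ (j + 1) * M with hS
  have hS0 : ∀ j, S j ≠ 0 := fun j => by simp [hS, hM0]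
  have hSt : ∀ j, S j ≠ ∞ := fun j => ENNReal.mul_ne_top (by simp) hM
  have hpt : ∀ x, f x ^ q ≤ ∑' j, {y | S j < f y}.indicator (fun _ => (2 * S j) ^ q) x := by
    intro x
    rcases eq_or_ne (f x) 0 with h0 | h0
    · simp [h0, hq]
    · have hlim : Tendsto (fun n : ℕ => (2⁻¹ : ℝ≥0∞) ^ n * M) atTop (𝓝 (0 * M)) :=
        ENNReal.Tendsto.mul_const (ENNReal.tendsto_pow_atTop_nhds_zero_of_lt_one (by simp))
          (Or.inr hM)
      rw [zero_mul] at hlim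
      have hex : ∃ n : ℕ, (2⁻¹ : ℝ≥0∞) ^ n * M < f x :=
        (hlim.eventually (gt_mem_nhds (pos_iff_ne_zero.2 h0))).exists
      classical
      obtain ⟨n, hn⟩ : ∃ n, Nat.find hex = n := ⟨_, rfl⟩
      have hn1 := Nat.find_spec hex
      rw [hn] at hn1
      cases n with
      | zero => exact absurd (hfM x) (by simpa using hn1)
      | succ j =>
        have hn2 := Nat.find_min hex (m := j) (by omega)
        refine le_trans ?_ (ENNReal.le_tsum j)
        rw [Set.indicator_of_mem (show x ∈ {y | S j < f y} from hn1)]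
        refine ENNReal.rpow_le_rpow ((not_lt.1 hn2).trans_eq ?_) hq.le
        calc (2⁻¹ : ℝ≥0∞) ^ j * M = 2⁻¹ * 2 * ((2⁻¹ : ℝ≥0∞) ^ j * M) := by
              rw [ENNReal.inv_mul_cancel (by simp) (by simp), one_mul]
          _ = 2 * S j := by rw [hS]; ring
  have hmeas : ∀ j, MeasurableSet {y | S j < f y} := fun j => measurableSet_lt measurable_const hf
  calc ∫⁻ x, f x ^ q ∂μ
      ≤ ∫⁻ x, ∑' j, {y | S j < f y}.indicator (fun _ => (2 * S j) ^ q) x ∂μ := lintegral_mono hpt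
    _ = ∑' j, (2 * S j) ^ q * μ {y | S j < f y} := by
        rw [lintegral_tsum fun j => (measurable_const.indicator (hmeas j)).aemeasurable]
        exact tsum_congr fun j => lintegral_indicator_const (hmeas j) _
    _ ≤ ∑' j, 2 ^ q * (((2⁻¹ : ℝ≥0∞) ^ (q - p)) ^ (j + 1) * (A ^ p * M ^ (q - p))) := by
        refine ENNReal.tsum_le_tsum fun j => ?_
        have h1 : μ {y | S j < f y} ≤ A ^ p * S j ^ (-p) := by
          have h := hA (S j)
          rw [mul_comm, ← ENNReal.le_div_iff_mul_le (Or.inl (hS0 j)) (Or.inl (hSt j)), one_div,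
            ENNReal.rpow_inv_le_iff hp, ENNReal.div_rpow_of_nonneg _ _ hp.le] at h
          rwa [ENNReal.rpow_neg, ← div_eq_mul_inv]
        calc (2 * S j) ^ q * μ {y | S j < f y}
            ≤ (2 * S j) ^ q * (A ^ p * S j ^ (-p)) := by gcongr
          _ = 2 ^ q * ((S j ^ q * S j ^ (-p)) * A ^ p) := by
              rw [ENNReal.mul_rpow_of_nonneg _ _ hq.le]; ring
          _ = 2 ^ q * (S j ^ (q - p) * A ^ p) := by
              rw [← ENNReal.rpow_add _ _ (hS0 j) (hSt j), sub_eq_add_neg]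
          _ = _ := by
              rw [hS]
              simp only
              rw [ENNReal.mul_rpow_of_nonneg _ _ (sub_pos.2 hpq).le, ← ENNReal.rpow_natCast,
                ← ENNReal.rpow_natCast, ← ENNReal.rpow_mul, ← ENNReal.rpow_mul,
                mul_comm (q - p)]
              ring
    _ = _ := by
        rw [ENNReal.tsum_mul_left, ENNReal.tsum_mul_right, weakTypeConst]
        ring

/-- The constant in `eLpNorm_le_of_weak_type`. -/
noncomputable def weakTypeLpConst (p : ℝ) (q : ℝ≥0∞) : ℝ≥0∞ :=
  if q = ∞ then 1 else weakTypeConst p q.toReal ^ (1 / q.toReal)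

theorem weakTypeLpConst_ne_top {p : ℝ} {q : ℝ≥0∞} (hp : 0 < p) (hpq : ENNReal.ofReal p < q) :
    weakTypeLpConst p q ≠ ∞ := by
  unfold weakTypeLpConst
  split_ifs with h
  · simp
  · exact ENNReal.rpow_ne_top_of_nonneg (by positivity)
      (weakTypeConst_ne_top hp ((ENNReal.ofReal_lt_iff_lt_toReal hp.le h).1 hpq))

/-- A function of weak type `p` that is bounded by `M` is in `L^q` for `q > p`. -/
theorem eLpNorm_le_of_weak_type {f : α → ℝ≥0∞} (hf : Measurable f) {p : ℝ} {q : ℝ≥0∞}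
    (hp : 0 < p) (hpq : ENNReal.ofReal p < q) {A M : ℝ≥0∞} (hM0 : M ≠ 0) (hM : M ≠ ∞)
    (hA : ∀ s : ℝ≥0∞, s * μ {x | s < f x} ^ (1 / p) ≤ A) (hfM : ∀ x, f x ≤ M) :
    eLpNorm f q μ ≤
      weakTypeLpConst p q * (A ^ (p * (q⁻¹).toReal) * M ^ (1 - p * (q⁻¹).toReal)) := by
  rcases eq_or_ne q ∞ with rfl | hq
  · simp only [weakTypeLpConst, if_true, eLpNorm_exponent_top, ENNReal.inv_top,
      ENNReal.toReal_zero, mul_zero, sub_zero, ENNReal.rpow_zero, ENNReal.rpow_one, one_mul]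
    exact essSup_le_of_ae_le _ (ae_of_all _ hfM)
  · have hpq' := (ENNReal.ofReal_lt_iff_lt_toReal hp.le hq).1 hpq
    have hqr : 0 < q.toReal := hp.trans hpq'
    have hq0 : q ≠ 0 := (ENNReal.toReal_pos_iff.1 hqr).1.ne'
    rw [eLpNorm_eq_lintegral_rpow_enorm_toReal hq0 hq]
    simp only [enorm_eq_self]
    refine (ENNReal.rpow_le_rpow (lintegral_rpow_le_of_weak_type hf hp hpq' hM0 hM hA hfM)
      (by positivity)).trans_eq ?_
    rw [ENNReal.mul_rpow_of_nonneg _ _ (by positivity), ENNReal.mul_rpow_of_nonneg _ _ (by positivity),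
      ← ENNReal.rpow_mul, ← ENNReal.rpow_mul, weakTypeLpConst, if_neg hq, ENNReal.toReal_inv]
    congr 4
    · field_simp
    · field_simp

theorem tsum_mul_measure_le_lintegral {J : Type*} {E : J → Set α}
    (hE : ∀ k, MeasurableSet (E k)) (hd : Pairwise (Function.onFun Disjoint E)) {f : α → ℝ≥0∞}
    {c : J → ℝ≥0∞} (hc : ∀ k, ∀ x ∈ E k, c k ≤ f x) : ∑' k, c k * μ (E k) ≤ ∫⁻ x, f x ∂μ := by
  rw [ENNReal.tsum_eq_iSup_sum]
  refine iSup_le fun s => ?_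
  calc ∑ k ∈ s, c k * μ (E k) ≤ ∑ k ∈ s, ∫⁻ x in E k, f x ∂μ := by
        refine Finset.sum_le_sum fun k _ => ?_
        rw [← setLIntegral_const]
        exact setLIntegral_mono' (hE k) (hc k)
    _ = ∫⁻ x in ⋃ k ∈ s, E k, f x ∂μ :=
        (lintegral_biUnion_finset (fun i _ j _ hij => hd hij) (fun k _ => hE k) f).symm
    _ ≤ ∫⁻ x, f x ∂μ := setLIntegral_le_lintegral _ _

theorem le_essSup_restrict_of_isOpen [TopologicalSpace α] [OpensMeasurableSpace α]
    [μ.IsOpenPosMeasure] {h : α → ℝ≥0∞} {S V : Set α} (hV : IsOpen V) (hne : V.Nonempty)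
    (hVS : V ⊆ S) {c : ℝ≥0∞} (hc : ∀ x ∈ V, c ≤ h x) : c ≤ essSup h (μ.restrict S) := by
  by_contra hlt
  have h1 := ae_lt_of_essSup_lt (not_le.1 hlt)
  have h2 : μ.restrict S V = 0 := measure_mono_null (fun x hx => not_lt.2 (hc x hx)) h1
  rw [Measure.restrict_apply hV.measurableSet, Set.inter_eq_left.2 hVS] at h2
  exact (hV.measure_pos μ hne).ne' h2

end Lp

section Finite

variable {I : Type*}

theorem tsum_indicator_le_mul_iSup {P : Set I} {n : ℕ} (hP : P.encard ≤ n) (a : I → ℝ≥0∞) :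
    ∑' i, P.indicator a i ≤ n * ⨆ i ∈ P, a i := by
  have hfin : P.Finite := Set.finite_of_encard_le_coe hP
  lift P to Finset I using hfin
  rw [Set.encard_coe_eq_coe_finsetCard, Nat.cast_le] at hP
  rw [tsum_eq_sum (s := P) (fun i hi => Set.indicator_of_notMem (by simpa using hi) _)]
  calc ∑ i ∈ P, (P : Set I).indicator a i ≤ P.card • ⨆ i ∈ (P : Set I), a i := by
        refine Finset.sum_le_card_nsmul _ _ _ fun i hi => ?_
        rw [Set.indicator_of_mem (by simpa using hi)]
        exact le_iSup₂_of_le i hi le_rfl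
    _ ≤ _ := by
        rw [nsmul_eq_mul]
        gcongr

theorem count_le_of_forall_finset {P : Set I} {B : ℝ≥0∞}
    (h : ∀ T : Finset I, (T : Set I) ⊆ P → (T.card : ℝ≥0∞) ≤ B) :
    @Measure.count I ⊤ P ≤ B := by
  let _ : MeasurableSpace I := ⊤
  have : (Measure.count P : ℝ≥0∞) = ∑' i, P.indicator (fun _ => (1 : ℝ≥0∞)) i := by
    rw [← lintegral_count, lintegral_indicator_const MeasurableSpace.measurableSet_top, one_mul]
  rw [this, ENNReal.tsum_eq_iSup_sum]
  classical
  refine iSup_le fun T => ?_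
  refine le_trans (le_of_eq ?_) (h (T.filter (· ∈ P)) (by intro i; simp))
  simp [Set.indicator_apply]

end Finite

section WeakLp

variable {G : Type*} [MeasurableSpace G] (μ : Measure G) (m F : G → ℝ≥0∞)

theorem mul_measure_rpow_le_weakLp {p : ℝ} (hp : 0 < p) (s : ℝ≥0∞) :
    s * μ {x | s < F x * m x} ^ (1 / p) ≤ weakLp μ m p F := by
  have hp' : 0 < 1 / p := one_div_pos.2 hp
  have key : ∀ t : ℝ≥0, 0 < t → (t : ℝ≥0∞) < μ {x | s < F x * m x} →
      (t : ℝ≥0∞) ^ (1 / p) * s ≤ weakLp μ m p F := by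
    intro t ht htμ
    refine le_trans ?_ (le_iSup₂_of_le t ht le_rfl)
    gcongr
    refine le_sInf fun s' hs' => ?_
    by_contra hlt
    refine absurd (htμ.trans_le (le_trans (measure_mono fun x hx => ?_) hs')) (lt_irrefl _)
    exact (not_le.1 hlt).trans hx
  rcases eq_or_ne (μ {x | s < F x * m x}) 0 with h0 | h0
  · simp [h0, hp]
  obtain ⟨u, -, hu, hlim⟩ := exists_seq_strictMono_tendsto' (pos_iff_ne_zero.2 h0)
  rw [mul_comm]
  rcases eq_or_ne s 0 with rfl | hs0
  · simp
  refine le_of_tendsto (ENNReal.Tendsto.mul_const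
    ((ENNReal.continuous_rpow_const.tendsto _).comp hlim)
    (Or.inl ?_)) (Eventually.of_forall fun n => ?_)
  · simp [ENNReal.rpow_eq_zero_iff, h0, hp.le]
  · have hne : u n ≠ ∞ := (hu n).2.ne_top
    lift u n to ℝ≥0 using hne with t ht
    have := hu n
    rw [← ht] at this
    simpa [← ht] using key t (by exact_mod_cast this.1) this.2

theorem weakLp_le_of_le_indicator {p : ℝ} (hp : 0 < p) {E : Set G} {a : ℝ≥0∞}
    (h : ∀ x, F x * m x ≤ E.indicator (fun _ => a) x) : weakLp μ m p F ≤ a * μ E ^ (1 / p) := by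
  refine iSup₂_le fun t ht => ?_
  rcases le_or_gt (μ E) t with hE | hE
  · have : rearrangement μ (fun x => F x * m x) t = 0 := by
      refine le_antisymm (sInf_le ?_) bot_le
      refine le_trans (measure_mono fun x hx => ?_) hE
      by_contra hxE
      have := hx.trans_le (h x)
      simp [hxE] at this
    simp [this]
  · rw [mul_comm]
    gcongr
    refine sInf_le ?_
    have : {x | a < F x * m x} = ∅ := by
      ext x
      simp only [Set.mem_ofPred_eq, Set.mem_empty_iff_false, iff_false, not_lt]
      exact (h x).trans (Set.indicator_le_self' (by simp) x)
    simp [distribution, this]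

end WeakLp

theorem apply_le_opNorm_mul {E : Type*} {B : Set E} {ρ : E → ℝ≥0∞} (T : E → E) {F : E}
    (hF : F ∈ B) {c : ℝ≥0∞} (hc0 : c ≠ 0) (hc : c ≠ ∞) (hρ : ρ F ≤ c) :
    ρ (T F) ≤ opNorm B ρ T * c := by
  rw [← ENNReal.div_le_iff_le_mul (Or.inl hc0) (Or.inl hc)]
  refine le_iInf₂ fun C hC => ?_
  rw [ENNReal.div_le_iff_le_mul (Or.inl hc0) (Or.inl hc)]
  exact (hC F hF).trans (by gcongr)

section Weights

variable {G : Type*} [Group G] [TopologicalSpace G] [MeasurableSpace G]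

/-- Measurable positive weights that change by at most a constant factor under right
multiplication by elements of a compact set. -/
structure IsLocallyModerate (M : G → ℝ≥0∞) : Prop where
  measurable : Measurable M
  ne_zero : ∀ x, M x ≠ 0
  ne_top : ∀ x, M x ≠ ∞
  compare : ∀ K : Set G, IsCompact K → ∃ C : ℝ≥0, C ≠ 0 ∧ ∀ z, ∀ k ∈ K,
    M (z * k) ≤ C * M z ∧ M z ≤ C * M (z * k)

theorem IsModerateWeight.isLocallyModerate [IsTopologicalGroup G] {w m : G → ℝ}
    (hw : IsSubmultiplicativeWeight w) (hm : IsModerateWeight w m) :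
    IsLocallyModerate fun x => ENNReal.ofReal (m x) := by
  obtain ⟨hwc, hwp, -⟩ := hw
  obtain ⟨hmm, hmp, hmw⟩ := hm
  refine ⟨hmm.ennreal_ofReal, fun x => by simpa using hmp x, fun x => ENNReal.ofReal_ne_top,
    fun K hK => ?_⟩
  obtain ⟨B, hB⟩ := (hK.union hK.inv).bddAbove_image hwc.continuousOn
  have hB' : ∀ k ∈ K ∪ K⁻¹, w k ≤ B := fun k hk => hB (Set.mem_image_of_mem w hk)
  have hstep : ∀ z, ∀ k ∈ K ∪ K⁻¹, m (z * k) ≤ w 1 * max B 1 * m z := fun z k hk => by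
    have h := hmw 1 z k
    rw [one_mul] at h
    calc m (z * k) ≤ w 1 * m z * w k := h
      _ ≤ w 1 * m z * max B 1 := by
          have := mul_pos (hwp 1) (hmp z)
          gcongr
          exact (hB' k hk).trans (le_max_left _ _)
      _ = _ := by ring
  have hpos : 0 < w 1 * max B 1 := mul_pos (hwp 1) (lt_max_of_lt_right one_pos)
  refine ⟨(w 1 * max B 1).toNNReal, by simpa using hpos, fun z k hk => ?_⟩
  have hcoe : (((w 1 * max B 1).toNNReal : ℝ≥0) : ℝ≥0∞) = ENNReal.ofReal (w 1 * max B 1) := rfl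
  rw [hcoe, ← ENNReal.ofReal_mul hpos.le, ← ENNReal.ofReal_mul hpos.le]
  refine ⟨ENNReal.ofReal_le_ofReal (hstep z k (Or.inl hk)), ENNReal.ofReal_le_ofReal ?_⟩
  simpa using hstep (z * k) k⁻¹ (Or.inr (by simpa using hk))

end Weights

section Separated

variable {G : Type*} [Group G]

/-- A maximal family of disjoint translates `z U` of a symmetric set has the property that the
sets `z U²` cover the group. -/
theorem exists_pairwise_disjoint_cover {U : Set G} (hU : U⁻¹ = U) :
    ∃ Z : Set G, Pairwise (Function.onFun Disjoint fun z : Z => (z : G) • U) ∧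
      ∀ s : G, U.Nonempty → ∃ z ∈ Z, z⁻¹ * s ∈ U * U := by
  obtain ⟨Z, hZ⟩ := zorn_subset {S : Set G | S.PairwiseDisjoint fun z => z • U} (by
    intro c hc hchain
    refine ⟨⋃₀ c, ?_, fun s hs => Set.subset_sUnion_of_mem hs⟩
    exact (Set.pairwiseDisjoint_sUnion hchain.directedOn).2 fun s hs => hc hs)
  refine ⟨Z, fun x y hxy => hZ.prop x.2 y.2 (fun h => hxy (Subtype.ext h)), fun s hUne => ?_⟩
  by_contra hcon
  push Not at hcon
  have hdisj : ∀ z ∈ Z, Disjoint (s • U) (z • U) := by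
    intro z hz
    rw [Set.disjoint_left]
    rintro _ ⟨u, hu, rfl⟩ ⟨u', hu', h⟩
    refine hcon z hz ⟨u', hu', u⁻¹, by rwa [← Set.mem_inv, hU], ?_⟩
    simp only [smul_eq_mul] at h
    simp only
    rw [eq_inv_mul_iff_mul_eq, ← mul_assoc, h, mul_inv_cancel_right]
  have hins : insert s Z ∈ {S : Set G | S.PairwiseDisjoint fun z => z • U} :=
    hZ.prop.insert fun z hz _ => hdisj z hz
  have hsZ : s ∈ Z := hZ.le_of_ge hins (Set.subset_insert s Z) (Set.mem_insert s Z)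
  have h1 := hdisj s hsZ
  rw [disjoint_self, Set.bot_eq_empty, Set.smul_set_eq_empty] at h1
  exact hUne.ne_empty h1

end Separated

section Control

variable {G : Type*} [Group G] [TopologicalSpace G] [IsTopologicalGroup G]
  [MeasurableSpace G] [BorelSpace G] (μ : Measure G) [μ.IsMulLeftInvariant]

theorem control_eq_essSup (Q : Set G) (F : G → ℝ≥0∞) (x : G) :
    control μ Q F x = essSup (fun y => F (x * y)) (μ.restrict Q) := by
  have he : MeasurableEmbedding fun y : G => x * y := measurableEmbedding_mulLeft x
  have hmap : μ.restrict (x • Q) = (μ.restrict Q).map (fun y => x * y) := by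
    have h := he.restrict_map μ (x • Q)
    rw [map_mul_left_eq_self] at h
    rw [h]
    congr 2
    ext y
    simp [Set.mem_smul_set_iff_inv_smul_mem]
  rw [control, hmap, he.essSup_map_measure]
  rfl

theorem lowerSemicontinuous_control {Q : Set G} (hQm : MeasurableSet Q)
    (hQ : IsCompact (closure Q)) {F : G → ℂ} (hF : Continuous F) :
    LowerSemicontinuous (control μ Q fun x => ‖F x‖ₑ) := by
  intro s₀ c hc
  obtain ⟨c', hcc', hc'⟩ := exists_between hc
  have hev : ∀ᶠ s in 𝓝 s₀, ∀ y ∈ closure Q, edist (F (s₀ * y)) (F (s * y)) < c' - c := by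
    refine hQ.eventually_forall_of_forall_eventually fun y _ => ?_
    have hcont : Continuous fun z : G × G => edist (F (s₀ * z.2)) (F (z.1 * z.2)) := by
      fun_prop
    refine hcont.continuousAt.eventually (gt_mem_nhds ?_)
    simpa using hcc'
  filter_upwards [hev] with s hs
  by_contra hle
  refine absurd (hc'.trans_le ?_) (lt_irrefl _)
  rw [control_eq_essSup] at hle ⊢
  refine essSup_le_of_ae_le _ ?_
  filter_upwards [ENNReal.ae_le_essSup fun y => ‖F (s * y)‖ₑ, ae_restrict_mem hQm] with y hy hyQ
  have h1 := (hs y (subset_closure hyQ)).le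
  calc ‖F (s₀ * y)‖ₑ = ‖F (s * y) + (F (s₀ * y) - F (s * y))‖ₑ := by
        congr 1; ring
    _ ≤ ‖F (s * y)‖ₑ + ‖F (s₀ * y) - F (s * y)‖ₑ := enorm_add_le _ _
    _ ≤ c + (c' - c) := by
        gcongr
        · exact hy.trans (not_lt.1 hle)
        · rwa [← edist_eq_enorm_sub]
    _ = c' := add_tsub_cancel_of_le hcc'.le

end Control

theorem measure_rpow_ne_zero_of_isOpen {α : Type*} [TopologicalSpace α] [MeasurableSpace α]
    (μ : Measure α) [μ.IsOpenPosMeasure] {V : Set α} (hVo : IsOpen V) (hV : V.Nonempty) {p : ℝ}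
    (hp : 0 < p) : μ V ^ (1 / p) ≠ 0 := by
  simp [ENNReal.rpow_eq_zero_iff, (hVo.measure_pos μ hV).ne', hp.le]

section RightNorm

variable {G : Type*} [Group G] [TopologicalSpace G] [IsTopologicalGroup G]
  [MeasurableSpace G] [BorelSpace G] (μ : Measure G) [μ.IsHaarMeasure]

/-- Testing the operator norm of a right translation on an indicator function. -/
theorem exists_control_rightTranslate_le {Q : Set G} (hQ : IsRelCompactNhd Q)
    (hQm : MeasurableSet Q) {M : G → ℝ≥0∞} (hM : IsLocallyModerate M) {p : ℝ} (hp : 0 < p) :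
    ∃ C : ℝ≥0, C ≠ 0 ∧ ∀ z t : G, ∀ s : ℝ≥0∞,
      s * μ {y | ∃ o ∈ interior Q, z⁻¹ * (y * o) * t ∈ interior Q ∧ s < M y} ^ (1 / p) ≤
        rightNorm μ Q (weakLp μ M p) t * (C * M z) := by
  obtain ⟨hQ1, hQc⟩ := hQ
  set O := interior Q with hO
  have hOo : IsOpen O := isOpen_interior
  have h1O : (1 : G) ∈ O := mem_interior_iff_mem_nhds.2 hQ1
  set P : Set G := closure Q * (closure Q)⁻¹ with hP
  have hPc : IsCompact P := hQc.mul hQc.inv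
  have hOP : O ⊆ P := fun x hx => ⟨x, subset_closure (interior_subset hx), 1,
    by simpa using subset_closure (interior_subset h1O), by simp⟩
  obtain ⟨C, hC0, hC⟩ := hM.compare P hPc
  have hPt : μ P ^ (1 / p) ≠ ∞ := ENNReal.rpow_ne_top_of_nonneg (by positivity) hPc.measure_ne_top
  have hP0 : μ P ^ (1 / p) ≠ 0 := by
    have := (hOo.measure_pos μ ⟨1, h1O⟩).trans_le (measure_mono hOP)
    simp [ENNReal.rpow_eq_zero_iff, this.ne', hp.le]
  have hcoe : ((C * (μ P ^ (1 / p)).toNNReal : ℝ≥0) : ℝ≥0∞) = C * μ P ^ (1 / p) := by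
    rw [ENNReal.coe_mul, ENNReal.coe_toNNReal hPt]
  refine ⟨C * (μ P ^ (1 / p)).toNNReal, ?_, fun z t s => ?_⟩
  · exact mul_ne_zero hC0 (ENNReal.toNNReal_ne_zero.2 ⟨hP0, hPt⟩)
  rw [hcoe]
  set F : G → ℂ := {y | z⁻¹ * y ∈ O}.indicator 1 with hF
  have hE : IsOpen {y | z⁻¹ * y ∈ O} := hOo.preimage (by fun_prop)
  have hFmeas : AEStronglyMeasurable F μ :=
    (measurable_one.indicator hE.measurableSet).aestronglyMeasurable
  have hctrl : ∀ y, control μ Q (fun x => ‖F x‖ₑ) y * M y ≤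
      {y | z⁻¹ * y ∈ P}.indicator (fun _ => C * M z) y := by
    intro y
    by_cases hy : z⁻¹ * y ∈ P
    · rw [Set.indicator_of_mem (by exact hy)]
      have h1 : control μ Q (fun x => ‖F x‖ₑ) y ≤ 1 := by
        refine essSup_le_of_ae_le _ (ae_of_all _ fun x => ?_)
        simp only [hF]
        by_cases hx : x ∈ {y | z⁻¹ * y ∈ O}
        · simp [Set.indicator_of_mem hx]
        · simp [Set.indicator_of_notMem hx]
      calc _ ≤ 1 * M y := by gcongr
        _ = M (z * (z⁻¹ * y)) := by simp
        _ ≤ _ := (hC z _ hy).1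
    · have h0 : control μ Q (fun x => ‖F x‖ₑ) y = 0 := by
        rw [control_eq_essSup]
        refine le_antisymm (essSup_le_of_ae_le _ ?_) bot_le
        filter_upwards [ae_restrict_mem hQm] with x hx
        have hxO : y * x ∉ {y | z⁻¹ * y ∈ O} := fun hxO => hy
          ⟨z⁻¹ * (y * x), subset_closure (interior_subset hxO), x⁻¹,
            by simpa using subset_closure hx, by group⟩
        simp [hF, Set.indicator_of_notMem hxO]
      simp [h0]
  have hnorm : amalgamNorm μ Q (weakLp μ M p) F ≤ C * μ P ^ (1 / p) * M z := by
    refine (weakLp_le_of_le_indicator μ M _ hp hctrl).trans_eq ?_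
    rw [show {y | z⁻¹ * y ∈ P} = (fun y => z⁻¹ * y) ⁻¹' P from rfl, measure_preimage_mul]
    ring
  have hct : C * μ P ^ (1 / p) * M z ≠ ∞ :=
    ENNReal.mul_ne_top (ENNReal.mul_ne_top ENNReal.coe_ne_top hPt) (hM.ne_top z)
  have hc0 : C * μ P ^ (1 / p) * M z ≠ 0 :=
    mul_ne_zero (mul_ne_zero (by simpa using hC0) hP0) (hM.ne_zero z)
  have hmem : F ∈ amalgamSpace μ Q (weakLp μ M p) := ⟨hFmeas, hnorm.trans_lt hct.lt_top⟩
  refine le_trans ?_ (apply_le_opNorm_mul (rightTranslate t) hmem hc0 hct hnorm)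
  refine le_trans ?_ (mul_measure_rpow_le_weakLp μ M _ hp s)
  gcongr with y
  rintro ⟨o, ho, hyo, hsy⟩
  refine hsy.trans_le (le_mul_of_one_le_left bot_le ?_)
  refine le_essSup_restrict_of_isOpen
    (V := {v | y⁻¹ * v ∈ O} ∩ {v | z⁻¹ * v * t ∈ O}) ?_ ⟨y * o, by simpa using ho, hyo⟩ ?_ ?_
  · exact (hOo.preimage (by fun_prop)).inter (hOo.preimage (by fun_prop))
  · intro v hv
    rw [Set.mem_smul_set_iff_inv_smul_mem]
    exact interior_subset hv.1
  · intro v hv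
    have hv' : v * t ∈ {y | z⁻¹ * y ∈ O} := by
      have := hv.2
      simpa [mul_assoc] using this
    simp [rightTranslate, hF, Set.indicator_of_mem hv']

/-- The weight restricted to a translate of a neighbourhood of the identity is controlled in `L^q`
by the operator norm of a right translation on the amalgam space over weak `L^p`. -/
theorem exists_eLpNorm_indicator_le_rightNorm {Q : Set G} (hQ : IsRelCompactNhd Q)
    (hQm : MeasurableSet Q) {M : G → ℝ≥0∞} (hM : IsLocallyModerate M) {p : ℝ} (hp : 0 < p)
    {q : ℝ≥0∞} (hpq : ENNReal.ofReal p < q) :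
    ∃ C : ℝ≥0, C ≠ 0 ∧ ∀ z t : G,
      (∀ y ∈ {y | z⁻¹ * y * t ∈ interior Q}, M y ≤ C * rightNorm μ Q (weakLp μ M p) t * M z) ∧
      eLpNorm ({y | z⁻¹ * y * t ∈ interior Q}.indicator M) q μ ≤
        C * rightNorm μ Q (weakLp μ M p) t * M z := by
  obtain ⟨C₁, hC₁0, hC₁⟩ := exists_control_rightTranslate_le μ hQ hQm hM hp
  obtain ⟨hQ1, hQc⟩ := hQ
  set O := interior Q with hO
  have hOo : IsOpen O := isOpen_interior
  have h1O : (1 : G) ∈ O := mem_interior_iff_mem_nhds.2 hQ1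
  have hOc : O ⊆ closure Q := interior_subset.trans subset_closure
  obtain ⟨C₂, hC₂0, hC₂⟩ := hM.compare (closure Q) hQc
  set ν := μ O⁻¹ ^ (1 / p) with hν
  have hν0 : ν ≠ 0 := measure_rpow_ne_zero_of_isOpen μ hOo.inv ⟨1, by simpa using h1O⟩ hp
  have hνt : ν ≠ ∞ := ENNReal.rpow_ne_top_of_nonneg (by positivity)
    (measure_ne_top_of_subset (Set.inv_subset_inv.2 hOc) hQc.inv.measure_ne_top)
  set K : ℝ≥0∞ := max (C₁ : ℝ≥0∞) (C₂ * C₁ / ν) with hK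
  have hKt : K ≠ ∞ := by
    simp only [hK, ne_eq, max_eq_top, ENNReal.coe_ne_top, false_or]
    exact (ENNReal.div_ne_top (ENNReal.mul_ne_top ENNReal.coe_ne_top ENNReal.coe_ne_top) hν0)
  have hweak : ∀ z t : G, ∀ s : ℝ≥0∞,
      s * μ {y | s < {y | z⁻¹ * y * t ∈ O}.indicator M y} ^ (1 / p) ≤
        K * rightNorm μ Q (weakLp μ M p) t * M z := by
    intro z t s
    calc _ ≤ rightNorm μ Q (weakLp μ M p) t * (C₁ * M z) := by
          refine le_trans ?_ (hC₁ z t s)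
          gcongr with y
          intro hy
          have hyE : y ∈ {y | z⁻¹ * y * t ∈ O} := by
            by_contra h
            rw [Set.indicator_of_notMem h] at hy
            exact not_lt_bot hy
          rw [Set.indicator_of_mem hyE] at hy
          exact ⟨1, h1O, by simpa using hyE, hy⟩
      _ ≤ rightNorm μ Q (weakLp μ M p) t * (K * M z) := by
          gcongr
          exact le_max_left _ _
      _ = _ := by ring
  have hsup : ∀ z t : G, ∀ y ∈ {y | z⁻¹ * y * t ∈ O},
      M y ≤ K * rightNorm μ Q (weakLp μ M p) t * M z := by
    intro z t y₀ hy₀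
    have h1 : ∀ s < M y₀ / C₂, s ≤ rightNorm μ Q (weakLp μ M p) t * (C₁ * M z) / ν := by
      intro s hs
      rw [ENNReal.le_div_iff_mul_le (Or.inl hν0) (Or.inl hνt)]
      refine le_trans ?_ (hC₁ z t s)
      have : ν = μ ((fun y => y₀⁻¹ * y) ⁻¹' O⁻¹) ^ (1 / p) := by
        rw [measure_preimage_mul]
      rw [this]
      gcongr
      intro y hy
      have hy' : y⁻¹ * y₀ ∈ O := by simpa using hy
      refine ⟨y⁻¹ * y₀, hy', by simpa using hy₀, hs.trans_le ?_⟩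
      refine ENNReal.div_le_of_le_mul' ?_
      have := (hC₂ y _ (hOc hy')).1
      rwa [mul_inv_cancel_left] at this
    have h2 := le_of_forall_lt_imp_le_of_dense h1
    rw [ENNReal.div_le_iff (by simpa using hC₂0) (by simp)] at h2
    refine h2.trans ?_
    calc _ = (C₂ * C₁ / ν) * rightNorm μ Q (weakLp μ M p) t * M z := by
          simp only [div_eq_mul_inv]; ring
      _ ≤ _ := by
          gcongr
          exact le_max_right _ _
  have hWt := weakTypeLpConst_ne_top hp hpq
  set L : ℝ≥0∞ := K + weakTypeLpConst p q * K with hL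
  have hLt : L ≠ ∞ := ENNReal.add_ne_top.2 ⟨hKt, ENNReal.mul_ne_top hWt hKt⟩
  have hL0 : L ≠ 0 := by
    have : K ≠ 0 := ne_bot_of_le_ne_bot (b := (C₁ : ℝ≥0∞)) (by simpa using hC₁0) (le_max_left _ _)
    simp [hL, this]
  refine ⟨L.toNNReal, by simp [ENNReal.toNNReal_eq_zero_iff, hL0, hLt], fun z t => ?_⟩
  rw [ENNReal.coe_toNNReal hLt]
  have hKL : K ≤ L := le_self_add
  refine ⟨fun y hy => (hsup z t y hy).trans (by gcongr), ?_⟩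
  set A := rightNorm μ Q (weakLp μ M p) t with hA
  rcases eq_or_ne A ∞ with hAt | hAt
  · rw [hAt, ENNReal.mul_top hL0, ENNReal.top_mul (hM.ne_zero z)]
    exact le_top
  set X := K * A * M z with hX
  have hXt : X ≠ ∞ := ENNReal.mul_ne_top (ENNReal.mul_ne_top hKt hAt) (hM.ne_top z)
  have hX0 : X ≠ 0 := by
    have h := hsup z t (z * t⁻¹) (by simpa using h1O)
    exact ne_bot_of_le_ne_bot (hM.ne_zero _) h
  have hmeas : Measurable ({y | z⁻¹ * y * t ∈ O}.indicator M) :=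
    hM.measurable.indicator (hOo.preimage (by fun_prop)).measurableSet
  have h := eLpNorm_le_of_weak_type (μ := μ) hmeas hp hpq hX0 hXt (hweak z t)
    (fun y => by
      by_cases hy : y ∈ {y | z⁻¹ * y * t ∈ O}
      · rw [Set.indicator_of_mem hy]; exact hsup z t y hy
      · rw [Set.indicator_of_notMem hy]; exact bot_le)
  rw [← ENNReal.rpow_add _ _ hX0 hXt, add_sub_cancel, ENNReal.rpow_one] at h
  refine h.trans ?_
  calc weakTypeLpConst p q * X = weakTypeLpConst p q * K * A * M z := by rw [hX]; ring
    _ ≤ L * A * M z := by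
        gcongr
        exact le_add_self

end RightNorm

section RNorm

variable {G : Type*} [Group G] [TopologicalSpace G] [IsTopologicalGroup G]
  [MeasurableSpace G] [BorelSpace G] (μ : Measure G) [μ.IsHaarMeasure]

/-- Weak `L^p` on a group with an infinite family of disjoint translates of an open set has an
equivalent `r`-norm only for `r ≤ p`. -/
theorem HasRNorm.le_of_infinite {M : G → ℝ≥0∞} (hM : IsLocallyModerate M) {p r : ℝ} (hp : 0 < p)
    (hr : HasRNorm (weakLp μ M p) r) {U : Set G} (hUo : IsOpen U) (hUne : U.Nonempty)
    (hUc : IsCompact (closure U)) {Z : Set G}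
    (hZ : Pairwise (Function.onFun Disjoint fun z : Z => (z : G) • U)) (hinf : Z.Infinite) :
    r ≤ p := by
  obtain ⟨hr0, -, N', ⟨c, C, hc0, hcC⟩, hhom, htri⟩ := hr
  obtain ⟨C₁, hC₁0, hC₁⟩ := hM.compare _ hUc
  have hp' : 0 < 1 / p := one_div_pos.2 hp
  have hμ0 : μ U ≠ 0 := (hUo.measure_pos μ hUne).ne'
  have hμt : μ U ≠ ∞ := measure_ne_top_of_subset subset_closure hUc.measure_ne_top
  set F : G → G → ℝ≥0∞ := fun z => (z • U).indicator fun _ => (M z)⁻¹ with hF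
  have hFm : ∀ z, Measurable (F z) := fun z =>
    measurable_const.indicator (hUo.smul z).measurableSet
  have hmem : ∀ z y, y ∈ z • U → ∃ u ∈ closure U, y = z * u := by
    rintro z _ ⟨u, hu, rfl⟩
    exact ⟨u, subset_closure hu, rfl⟩
  set B : ℝ≥0∞ := C * (C₁ * μ U ^ (1 / p)) with hB
  have hBt : B ≠ ∞ := ENNReal.mul_ne_top ENNReal.coe_ne_top
    (ENNReal.mul_ne_top ENNReal.coe_ne_top (ENNReal.rpow_ne_top_of_nonneg hp'.le hμt))
  have hFB : ∀ z, N' (F z) ≤ B := by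
    intro z
    refine (hcC (F z)).2.trans ?_
    rw [hB]
    gcongr
    have := weakLp_le_of_le_indicator μ M (F z) hp (E := z • U) (a := C₁) (fun y => by
      by_cases hy : y ∈ z • U
      · simp only [hF]
        rw [Set.indicator_of_mem hy, Set.indicator_of_mem hy, mul_comm, ← div_eq_mul_inv]
        refine ENNReal.div_le_of_le_mul ?_
        obtain ⟨u, hu, rfl⟩ := hmem z y hy
        exact (hC₁ z u hu).1
      · simp [hF, Set.indicator_of_notMem hy])
    rwa [measure_smul] at this
  have hupper : ∀ T : Finset G, N' (fun y => ∑ z ∈ T, F z y) ^ r ≤ T.card * B ^ r := by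
    classical
    intro T
    induction T using Finset.induction_on with
    | empty =>
      have := hhom 0 (F 1)
      simp only [ENNReal.coe_zero, zero_mul] at this
      simp [this, hr0]
    | insert z T hz ih =>
      simp only [Finset.sum_insert hz, Finset.card_insert_of_notMem hz]
      refine (htri _ _ (hFm z) (Finset.measurable_fun_sum T fun i _ => hFm i)).trans ?_
      rw [Nat.cast_add, Nat.cast_one, add_mul, one_mul, add_comm]
      exact add_le_add ih (ENNReal.rpow_le_rpow (hFB z) hr0.le)
  set a : ℝ≥0∞ := c * ((C₁ : ℝ≥0∞)⁻¹ / 2 * μ U ^ (1 / p)) with ha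
  have ha0 : a ≠ 0 := by
    simp [ha, hc0.ne', ENNReal.rpow_eq_zero_iff, hμ0, hp.le]
  have hlower : ∀ n : ℕ, a * (n : ℝ≥0∞) ^ (1 / p) ≤ (n * B ^ r) ^ (1 / r) := by
    intro n
    obtain ⟨T, hTZ, hTn⟩ := hinf.exists_subset_card_eq n
    have h1 := hupper T
    rw [hTn, ← ENNReal.le_rpow_inv_iff hr0, ← one_div] at h1
    refine le_trans ?_ h1
    refine le_trans ?_ (hcC _).1
    rw [ha, mul_assoc]
    gcongr
    refine le_trans ?_
      (mul_measure_rpow_le_weakLp μ M (fun y => ∑ z ∈ T, F z y) hp ((C₁ : ℝ≥0∞)⁻¹ / 2))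
    refine le_trans (b := (C₁ : ℝ≥0∞)⁻¹ / 2 * μ (⋃ z ∈ T, z • U) ^ (1 / p)) (le_of_eq ?_) ?_
    · rw [measure_biUnion_finset]
      · have hsum : ∑ z ∈ T, μ (z • U) = n * μ U := by
          rw [Finset.sum_congr rfl fun z _ => measure_smul μ z U, Finset.sum_const, hTn, nsmul_eq_mul]
        rw [hsum, ENNReal.mul_rpow_of_nonneg _ _ hp'.le]
        ring
      · intro x hx y hy hxy
        exact hZ (i := ⟨x, hTZ hx⟩) (j := ⟨y, hTZ hy⟩) (by simpa using hxy)
      · exact fun z _ => (hUo.smul z).measurableSet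
    · refine mul_le_mul' le_rfl (ENNReal.rpow_le_rpow (measure_mono fun y hy => ?_) hp'.le)
      obtain ⟨z, hzT, hyz⟩ := Set.mem_iUnion₂.1 hy
      have h2 : (C₁ : ℝ≥0∞)⁻¹ / 2 < (C₁ : ℝ≥0∞)⁻¹ :=
        ENNReal.half_lt_self (by simp) (by simpa using hC₁0)
      refine h2.trans_le ?_
      refine le_trans ?_ (mul_le_mul_left (Finset.single_le_sum (f := fun z => F z y)
        (fun _ _ => bot_le) hzT) (M y))
      simp only [hF]
      rw [Set.indicator_of_mem hyz]
      obtain ⟨u, hu, rfl⟩ := hmem z y hyz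
      rw [mul_comm, ← div_eq_mul_inv, ENNReal.le_div_iff_mul_le (Or.inl (hM.ne_zero z))
        (Or.inl (hM.ne_top z)), mul_comm, ← div_eq_mul_inv]
      exact ENNReal.div_le_of_le_mul' (hC₁ z u hu).2
  by_contra hlt
  have hpr : 0 < 1 / p - 1 / r := sub_pos.2 (one_div_lt_one_div_of_lt hp (not_le.1 hlt))
  have hbd : ∀ n : ℕ, 1 ≤ n → (n : ℝ≥0∞) ^ (1 / p - 1 / r) ≤ B / a := by
    intro n hn
    have hn0 : (n : ℝ≥0∞) ≠ 0 := by simpa using (by omega : n ≠ 0)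
    have hnt : (n : ℝ≥0∞) ≠ ∞ := ENNReal.natCast_ne_top n
    have h := hlower n
    rw [ENNReal.mul_rpow_of_nonneg _ _ (by positivity), ← ENNReal.rpow_mul,
      mul_one_div_cancel hr0.ne', ENNReal.rpow_one] at h
    rw [ENNReal.le_div_iff_mul_le (Or.inl ha0) (Or.inr hBt), ENNReal.rpow_sub _ _ hn0 hnt, mul_comm,
      ← mul_div_assoc]
    exact ENNReal.div_le_of_le_mul' h
  have hlim : Tendsto (fun n : ℕ => (n : ℝ≥0∞) ^ (1 / p - 1 / r)) atTop (𝓝 ∞) :=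
    (ENNReal.tendsto_rpow_at_top hpr).comp ENNReal.tendsto_nat_nhds_top
  have := le_of_tendsto hlim (eventually_atTop.2 ⟨1, hbd⟩)
  exact (ENNReal.div_ne_top hBt ha0) (top_le_iff.1 this)

end RNorm

section Sequences

variable {G : Type*} [Group G] [TopologicalSpace G] {I : Type*}

theorem IsRelativelySeparated.exists_encard_le {X : I → G} (hX : IsRelativelySeparated X)
    {U : Set G} (hU : IsCompact (closure U)) :
    ∃ n : ℕ, ∀ y, {i | (X i)⁻¹ * y ∈ U}.encard ≤ n := by
  obtain ⟨n, hn⟩ := hX _ hU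
  refine ⟨n, fun y => ?_⟩
  rcases Set.eq_empty_or_nonempty {i | (X i)⁻¹ * y ∈ U} with he | ⟨j, hj⟩
  · simp [he]
  · refine (Set.encard_le_encard fun i hi => ?_).trans (hn j)
    refine ⟨y, ?_, ?_⟩ <;> rw [Set.mem_smul_set_iff_inv_smul_mem]
    · exact subset_closure hi
    · exact subset_closure hj

variable [IsTopologicalGroup G] [MeasurableSpace G] [BorelSpace G] (μ : Measure G) [μ.IsHaarMeasure]

/-- The sequence space associated with weak `L^p` embeds into weak `ℓ^p`. -/
theorem exists_weak_type_le_seqNorm {M : G → ℝ≥0∞} (hM : IsLocallyModerate M) {p : ℝ} (hp : 0 < p)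
    {X : I → G} (hX : IsRelativelySeparated X) {Q : Set G} (hQ : IsRelCompactNhd Q) :
    ∃ C : ℝ≥0, C ≠ 0 ∧ ∀ (c : I → ℂ) (s : ℝ≥0∞),
      s * @Measure.count I ⊤ {i | s < ‖c i‖ₑ * M (X i)} ^ (1 / p) ≤
        C * seqNorm (weakLp μ M p) Q X c := by
  obtain ⟨hQ1, hQc⟩ := hQ
  set O := interior Q with hO
  have hOo : IsOpen O := isOpen_interior
  have h1O : (1 : G) ∈ O := mem_interior_iff_mem_nhds.2 hQ1
  have hOc : O ⊆ closure Q := interior_subset.trans subset_closure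
  have hp' : 0 < 1 / p := one_div_pos.2 hp
  obtain ⟨C₁, hC₁0, hC₁⟩ := hM.compare _ hQc
  obtain ⟨n, hn⟩ := hX.exists_encard_le (U := O)
    (hQc.of_isClosed_subset isClosed_closure (closure_mono interior_subset))
  have hμ0 : μ O ≠ 0 := (hOo.measure_pos μ ⟨1, h1O⟩).ne'
  have hμt : μ O ≠ ∞ := measure_ne_top_of_subset hOc hQc.measure_ne_top
  set κ : ℝ≥0∞ := (n / μ O) ^ (1 / p) with hκ
  have hκt : κ ≠ ∞ := ENNReal.rpow_ne_top_of_nonneg hp'.le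
    (ENNReal.div_ne_top (ENNReal.natCast_ne_top n) hμ0)
  set C : ℝ≥0∞ := κ * C₁ + 1 with hC
  have hCt : C ≠ ∞ := ENNReal.add_ne_top.2 ⟨ENNReal.mul_ne_top hκt ENNReal.coe_ne_top, by simp⟩
  refine ⟨C.toNNReal, ENNReal.toNNReal_ne_zero.2 ⟨by simp [hC], hCt⟩, fun c s => ?_⟩
  rw [ENNReal.coe_toNNReal hCt]
  set F : G → ℝ≥0∞ := fun y => ∑' i, (X i • Q).indicator (fun _ => ‖c i‖ₑ) y with hF
  set E : Set G := {y | s / C₁ < F y * M y} with hE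
  have hsE : s / C₁ * μ E ^ (1 / p) ≤ seqNorm (weakLp μ M p) Q X c :=
    mul_measure_rpow_le_weakLp μ M F hp _
  have hcount : @Measure.count I ⊤ {i | s < ‖c i‖ₑ * M (X i)} ≤ n / μ O * μ E := by
    refine count_le_of_forall_finset fun T hT => ?_
    have hsub : ∀ i ∈ T, ∀ y, y ∈ X i • O → y ∈ E := by
      intro i hi y hy
      have h1 := hT hi
      have hyQ : y ∈ X i • Q := Set.smul_set_mono interior_subset hy
      have h2 : ‖c i‖ₑ ≤ F y := by
        refine le_trans ?_ (ENNReal.le_tsum i)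
        rw [Set.indicator_of_mem hyQ]
      obtain ⟨u, hu, rfl⟩ := hy
      refine (ENNReal.div_lt_iff (Or.inl (by simpa using hC₁0)) (Or.inl (by simp))).2 ?_
      calc s < ‖c i‖ₑ * M (X i) := h1
        _ ≤ F (X i • u) * (C₁ * M (X i • u)) := by
            gcongr
            exact (hC₁ _ u (hOc hu)).2
        _ = _ := by ring
    have hmeas : ∀ i, MeasurableSet (X i • O) := fun i => (hOo.smul _).measurableSet
    set V : Set G := ⋃ i ∈ T, X i • O with hV
    have hVm : MeasurableSet V := T.measurableSet_biUnion fun i _ => hmeas i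
    have h3 : (T.card : ℝ≥0∞) * μ O ≤ n * μ V := by
      calc (T.card : ℝ≥0∞) * μ O = ∑ i ∈ T, μ (X i • O) := by
            rw [Finset.sum_congr rfl fun i _ => measure_smul μ (X i) O, Finset.sum_const,
              nsmul_eq_mul]
        _ = ∫⁻ y, ∑ i ∈ T, (X i • O).indicator (fun _ => 1) y ∂μ := by
            rw [lintegral_finsetSum _ fun i _ => measurable_const.indicator (hmeas i)]
            refine Finset.sum_congr rfl fun i _ => ?_
            rw [lintegral_indicator_const (hmeas i), one_mul]
        _ ≤ ∫⁻ y, V.indicator (fun _ => (n : ℝ≥0∞)) y ∂μ := by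
            refine lintegral_mono fun y => ?_
            by_cases hy : y ∈ V
            · rw [Set.indicator_of_mem hy]
              refine (ENNReal.sum_le_tsum T).trans ?_
              have := tsum_indicator_le_mul_iSup (hn y) (fun _ => (1 : ℝ≥0∞))
              refine le_trans (le_of_eq ?_) (this.trans ?_)
              · refine tsum_congr fun i => ?_
                by_cases h : (X i)⁻¹ * y ∈ O
                · rw [Set.indicator_of_mem (Set.mem_smul_set_iff_inv_smul_mem.2 h),
                    Set.indicator_of_mem (by exact h)]
                · rw [Set.indicator_of_notMem (fun h' => h (Set.mem_smul_set_iff_inv_smul_mem.1 h')),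
                    Set.indicator_of_notMem (by exact h)]
              · calc (n : ℝ≥0∞) * _ ≤ n * 1 := by
                      gcongr
                      exact iSup₂_le fun _ _ => le_rfl
                  _ = n := mul_one _
            · rw [Set.indicator_of_notMem hy, Finset.sum_eq_zero]
              intro i hi
              refine Set.indicator_of_notMem (fun h => hy ?_) _
              exact Set.mem_biUnion hi h
        _ = n * μ V := lintegral_indicator_const hVm _
    have h4 : μ V ≤ μ E := measure_mono (Set.iUnion₂_subset fun i hi y hy => hsub i hi y hy)
    rw [mul_comm, ← mul_div_assoc, ENNReal.le_div_iff_mul_le (Or.inl hμ0) (Or.inl hμt), mul_comm (μ E)]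
    exact h3.trans (by gcongr)
  calc s * @Measure.count I ⊤ {i | s < ‖c i‖ₑ * M (X i)} ^ (1 / p)
      ≤ s * (n / μ O * μ E) ^ (1 / p) := by gcongr
    _ = κ * C₁ * (s / C₁ * μ E ^ (1 / p)) := by
        rw [ENNReal.mul_rpow_of_nonneg _ _ hp'.le, ← hκ]
        calc s * (κ * μ E ^ (1 / p)) = κ * (s / C₁ * C₁) * μ E ^ (1 / p) := by
              rw [ENNReal.div_mul_cancel (by simpa using hC₁0) (by simp)]; ring
          _ = _ := by ring
    _ ≤ C * seqNorm (weakLp μ M p) Q X c := by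
        gcongr
        exact le_self_add

end Sequences

theorem lintegral_tsum_of_countable {α I : Type*} [MeasurableSpace α] {μ : Measure α}
    {h : I → α → ℝ≥0∞} (hh : ∀ i, Measurable (h i)) {S : Set I} (hS : S.Countable)
    (h0 : ∀ i ∉ S, ∀ x, h i x = 0) : ∫⁻ x, ∑' i, h i x ∂μ = ∑' i, ∫⁻ x, h i x ∂μ := by
  have := hS.to_subtype
  have h1 : ∀ x, ∑' i, h i x = ∑' i : S, h i x := fun x =>
    (tsum_subtype_eq_of_support_subset (f := fun i => h i x)
      fun i hi => by_contra fun hiS => hi (h0 i hiS x)).symm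
  have h2 : ∑' i, ∫⁻ x, h i x ∂μ = ∑' i : S, ∫⁻ x, h i x ∂μ :=
    (tsum_subtype_eq_of_support_subset (f := fun i => ∫⁻ x, h i x ∂μ)
      fun i hi => by_contra fun hiS => hi (by simp [h0 i hiS])).symm
  rw [h2, lintegral_congr h1, lintegral_tsum fun i : S => (hh i).aemeasurable]

theorem eLpNorm_ennreal_const_mul {α : Type*} {_ : MeasurableSpace α} {μ : Measure α}
    {q : ℝ≥0∞} (hq0 : q ≠ 0) (c : ℝ≥0∞) {f : α → ℝ≥0∞} (hf : Measurable f) :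
    eLpNorm (fun x => c * f x) q μ = c * eLpNorm f q μ := by
  rcases eq_or_ne q ∞ with rfl | hqt
  · simp only [eLpNorm_exponent_top]
    exact ENNReal.essSup_const_mul
  · have hqr : 0 < q.toReal := ENNReal.toReal_pos hq0 hqt
    rw [eLpNorm_eq_lintegral_rpow_enorm_toReal hq0 hqt, eLpNorm_eq_lintegral_rpow_enorm_toReal hq0 hqt]
    simp only [enorm_eq_self, ENNReal.mul_rpow_of_nonneg _ _ hqr.le]
    rw [lintegral_const_mul _ (hf.pow_const _), ENNReal.mul_rpow_of_nonneg _ _ (by positivity),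
      ← ENNReal.rpow_mul, mul_one_div_cancel hqr.ne', ENNReal.rpow_one]

/-- The `L^q` quasi-norm of a supremum is at most the `ℓ^q` quasi-norm of the quasi-norms. -/
theorem eLpNorm_iSup_le {α I : Type*} [MeasurableSpace α] {μ : Measure α}
    {h : I → α → ℝ≥0∞} (hh : ∀ i, Measurable (h i)) {S : Set I} (hS : S.Countable)
    (h0 : ∀ i ∉ S, ∀ x, h i x = 0) {q : ℝ≥0∞} (hq0 : q ≠ 0) {b : I → ℝ≥0∞}
    (hb : ∀ i, eLpNorm (h i) q μ ≤ b i) :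
    eLpNorm (fun x => ⨆ i, h i x) q μ ≤ eLpNorm b q (@Measure.count I ⊤) := by
  let _ : MeasurableSpace I := ⊤
  rcases eq_or_ne q ∞ with rfl | hqt
  · simp only [eLpNorm_exponent_top] at hb ⊢
    refine essSup_le_of_ae_le _ ?_
    have hae : ∀ᵐ x ∂μ, ∀ i ∈ S, h i x ≤ b i := by
      refine (ae_ball_iff hS).2 fun i _ => ?_
      filter_upwards [ENNReal.ae_le_essSup fun x => ‖h i x‖ₑ] with x hx
      exact hx.trans (hb i)
    filter_upwards [hae] with x hx
    refine iSup_le fun i => ?_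
    rw [eLpNormEssSup, essSup_count]
    by_cases hi : i ∈ S
    · exact (hx i hi).trans (le_iSup (fun i => ‖b i‖ₑ) i)
    · simp [h0 i hi x]
  · have hqr : 0 < q.toReal := ENNReal.toReal_pos hq0 hqt
    have hk : ∀ i, ∫⁻ x, h i x ^ q.toReal ∂μ ≤ b i ^ q.toReal := fun i => by
      have := hb i
      rw [eLpNorm_eq_lintegral_rpow_enorm_toReal hq0 hqt, one_div,
        ENNReal.rpow_inv_le_iff hqr] at this
      simpa using this
    rw [eLpNorm_eq_lintegral_rpow_enorm_toReal hq0 hqt, eLpNorm_eq_lintegral_rpow_enorm_toReal hq0 hqt]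
    refine ENNReal.rpow_le_rpow ?_ (by positivity)
    simp only [enorm_eq_self]
    calc ∫⁻ x, (⨆ i, h i x) ^ q.toReal ∂μ
        ≤ ∫⁻ x, ∑' i, h i x ^ q.toReal ∂μ := by
          refine lintegral_mono fun x => ?_
          rw [← ENNReal.le_rpow_inv_iff hqr]
          refine iSup_le fun i => ?_
          rw [ENNReal.le_rpow_inv_iff hqr]
          exact ENNReal.le_tsum i
      _ = ∑' i, ∫⁻ x, h i x ^ q.toReal ∂μ :=
          lintegral_tsum_of_countable (fun i => (hh i).pow_const _) hS
            fun i hi x => by simp [h0 i hi x, hqr]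
      _ ≤ ∑' i, b i ^ q.toReal := ENNReal.tsum_le_tsum hk
      _ = _ := (lintegral_count _).symm

theorem exists_isOpen_symm_mul_subset {G : Type*} [Group G] [TopologicalSpace G]
    [IsTopologicalGroup G] {V : Set G} (hV : V ∈ 𝓝 (1 : G)) :
    ∃ U : Set G, IsOpen U ∧ (1 : G) ∈ U ∧ U⁻¹ = U ∧ U * U ⊆ V := by
  obtain ⟨U, hUo, hU1, hUV⟩ := exists_open_nhds_one_mul_subset hV
  refine ⟨U ∩ U⁻¹, hUo.inter hUo.inv, ⟨hU1, by simpa using hU1⟩, ?_, ?_⟩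
  · rw [Set.inter_inv, inv_inv, Set.inter_comm]
  · exact (Set.mul_subset_mul Set.inter_subset_left Set.inter_subset_left).trans hUV

section Kernel

variable {G : Type*} [Group G] [TopologicalSpace G] [IsTopologicalGroup G]
  [MeasurableSpace G] [BorelSpace G] (μ : Measure G) [μ.IsHaarMeasure]

/-- The discretized form of the condition `V_g g ∈ W(L^∞, W(L^∞, L^r_w)^∨)^∨`: the local suprema
`γ k` of the control function on the sets `U (z k)⁻¹`, weighted with numbers `D k` that control
translates of the weight, are summable to a power that is admissible for `L^q`. -/
theorem exists_discretized_kernel {Q : Set G} (hQ : IsRelCompactNhd Q)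
    (hQm : MeasurableSet Q) {M : G → ℝ≥0∞} (hM : IsLocallyModerate M) {p r : ℝ} (hp : 0 < p)
    {q : ℝ≥0∞} (hpq : ENNReal.ofReal p < q) (hr : HasRNorm (weakLp μ M p) r)
    {F : G → ℂ} (hF : Continuous F) (hFinv : ∀ x, ‖F x⁻¹‖ₑ = ‖F x‖ₑ)
    {W : G → ℝ≥0∞} (hW : ∀ x, rightNorm μ Q (weakLp μ M p) x ≤ W x)
    (hFW : vee (amalgam μ Q (vee (amalgam μ Q (weightedLp μ W (ENNReal.ofReal r)))))
      (fun x => ‖F x‖ₑ) < ∞) :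
    ∃ (U : Set G) (Z : Set G) (γ D : Z → ℝ≥0∞) (s : ℝ) (C : ℝ≥0),
      IsOpen U ∧ IsCompact (closure U) ∧
      (∀ x : G, ∃ k : Z, x * (k : G) ∈ U) ∧
      (∀ x : G, ∀ k : Z, x * (k : G) ∈ U → control μ Q (fun x => ‖F x‖ₑ) x ≤ γ k) ∧
      (∀ z, ∀ k : Z, eLpNorm ({y | z⁻¹ * y * (k : G) ∈ U}.indicator M) q μ ≤ C * D k * M z) ∧
      (∀ k, D k ≠ 0) ∧ 0 < s ∧ s ≤ 1 ∧ ENNReal.ofReal s ≤ q ∧ ∑' k, (γ k * D k) ^ s ≠ ∞ := by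
  obtain ⟨C, hC0, hC⟩ := exists_eLpNorm_indicator_le_rightNorm μ hQ hQm hM hp hpq
  obtain ⟨hr0, hr1, -⟩ := id hr
  set A := rightNorm μ Q (weakLp μ M p) with hA
  obtain ⟨hQ1, hQc⟩ := hQ
  set O := interior Q with hO
  have hOo : IsOpen O := isOpen_interior
  have h1O : (1 : G) ∈ O := mem_interior_iff_mem_nhds.2 hQ1
  obtain ⟨U, hUo, hU1, hUinv, hUU⟩ := exists_isOpen_symm_mul_subset (hOo.mem_nhds h1O)
  obtain ⟨T, hTo, hT1, hTinv, hTT⟩ := exists_isOpen_symm_mul_subset (hUo.mem_nhds hU1)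
  have hTU : T ⊆ U := fun x hx => hTT ⟨x, hx, 1, hT1, by simp⟩
  have hUO : U ⊆ O := fun x hx => hUU ⟨x, hx, 1, hU1, by simp⟩
  have hUc : IsCompact (closure U) := hQc.of_isClosed_subset isClosed_closure
    (closure_mono (hUO.trans interior_subset))
  have hTc : IsCompact (closure T) := hUc.of_isClosed_subset isClosed_closure (closure_mono hTU)
  obtain ⟨Z, hZd, hZc⟩ := exists_pairwise_disjoint_cover hTinv
  set Γ := control μ Q fun x => ‖F x‖ₑ with hΓ
  have hΓlsc : LowerSemicontinuous Γ := lowerSemicontinuous_control μ hQm hQc hF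
  set Φ : G → ℝ≥0∞ := control μ Q fun x => Γ x⁻¹ with hΦ
  have hfin : ∫⁻ x, (Φ x * W x) ^ r ∂μ ≠ ∞ := by
    have h1 : vee (amalgam μ Q (vee (amalgam μ Q (weightedLp μ W (ENNReal.ofReal r)))))
        (fun x => ‖F x‖ₑ) = eLpNorm (fun x => Φ x * W x) (ENNReal.ofReal r) μ := by
      simp only [vee, amalgam, weightedLp, hFinv]
      rfl
    rw [h1, eLpNorm_lt_top_iff_lintegral_rpow_enorm_lt_top
      (ENNReal.ofReal_pos.2 hr0).ne' ENNReal.ofReal_ne_top, ENNReal.toReal_ofReal hr0.le] at hFW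
    simpa using hFW.ne
  have hΓΦ : ∀ t x, t⁻¹ * x⁻¹ ∈ O → Γ x ≤ Φ t := by
    intro t x hx
    refine le_of_forall_lt_imp_le_of_dense fun c hc => ?_
    refine le_essSup_restrict_of_isOpen
      (V := {y | t⁻¹ * y ∈ O} ∩ {y | c < Γ y⁻¹}) ?_ ⟨x⁻¹, hx, by simpa using hc⟩ ?_ ?_
    · exact (hOo.preimage (by fun_prop)).inter
        ((hΓlsc.isOpen_preimage c).preimage continuous_inv)
    · intro y hy
      rw [Set.mem_smul_set_iff_inv_smul_mem]
      exact interior_subset hy.1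
    · exact fun y hy => le_of_lt hy.2
  set γ : Z → ℝ≥0∞ := fun k => ⨆ x ∈ {x : G | x * k ∈ U}, Γ x with hγ
  set D : Z → ℝ≥0∞ := fun k => ⨅ t ∈ (k : G) • T, A t with hD
  have hmemT : ∀ (k t : G), t ∈ k • T → k⁻¹ * t ∈ T := fun k t ht =>
    Set.mem_smul_set_iff_inv_smul_mem.1 ht
  have hinf : ∀ (k : Z) (z : G) (x : ℝ≥0∞),
      (∀ t ∈ (k : G) • T, x ≤ C * A t * M z) → x ≤ C * D k * M z := by
    intro k z x hx
    have h0 : (C : ℝ≥0∞) * M z ≠ 0 := mul_ne_zero (by simpa using hC0) (hM.ne_zero z)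
    have ht : (C : ℝ≥0∞) * M z ≠ ∞ := ENNReal.mul_ne_top ENNReal.coe_ne_top (hM.ne_top z)
    rw [mul_right_comm, mul_comm, ← ENNReal.div_le_iff_le_mul (Or.inl h0) (Or.inl ht)]
    refine le_iInf₂ fun t htT => ?_
    rw [ENNReal.div_le_iff_le_mul (Or.inl h0) (Or.inl ht), mul_comm, mul_right_comm]
    exact hx t htT
  have hsum : ∑' k, (γ k * D k) ^ r ≠ ∞ := by
    have hT0 : μ T ≠ 0 := (hTo.measure_pos μ ⟨1, hT1⟩).ne'
    have h1 : (∑' k, (γ k * D k) ^ r) * μ T ≤ ∫⁻ x, (Φ x * W x) ^ r ∂μ := by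
      rw [← ENNReal.tsum_mul_right]
      have h2 := tsum_mul_measure_le_lintegral (μ := μ) (E := fun k : Z => (k : G) • T)
        (fun k => (hTo.smul (k : G)).measurableSet) hZd (f := fun x => (Φ x * W x) ^ r)
        (c := fun k => (γ k * D k) ^ r) (fun k t ht => by
          refine ENNReal.rpow_le_rpow ?_ hr0.le
          refine mul_le_mul' (iSup₂_le fun x hx => hΓΦ t x ?_) ((iInf₂_le t ht).trans (hW t))
          have hx' : (k : G)⁻¹ * x⁻¹ ∈ U := by
            rw [← hUinv]
            simpa using hx
          have ht' : t⁻¹ * k ∈ T := by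
            rw [← hTinv]
            simpa using hmemT _ _ ht
          exact hUU ⟨t⁻¹ * k, hTU ht', (k : G)⁻¹ * x⁻¹, hx', by group⟩)
      simpa only [measure_smul] using h2
    intro htop
    rw [htop, ENNReal.top_mul hT0] at h1
    exact hfin (top_le_iff.1 h1)
  refine ⟨U, Z, γ, D, min r p, C, hUo, hUc, fun x => ?_, fun x k hx => ?_, fun z k => ?_,
    fun k hk => ?_, lt_min hr0 hp, (min_le_left _ _).trans hr1, ?_, ?_⟩
  · obtain ⟨k, hkZ, hk⟩ := hZc x⁻¹ ⟨1, hT1⟩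
    refine ⟨⟨k, hkZ⟩, ?_⟩
    rw [← hUinv]
    simpa using hTT hk
  · exact le_iSup₂_of_le (f := fun x (_ : x ∈ {x : G | x * k ∈ U}) => Γ x) x hx le_rfl
  · refine hinf k z _ fun t ht => le_trans (eLpNorm_mono_enorm fun y => ?_) (hC z t).2
    simp only [enorm_eq_self]
    refine Set.indicator_le_indicator_of_subset (fun y hy => ?_) (fun _ => bot_le) y
    refine hUU ⟨z⁻¹ * y * k, hy, (k : G)⁻¹ * t, hTU (hmemT _ _ ht), by group⟩
  · have h1 := hinf k 1 (M (k : G)⁻¹) fun t ht => (hC 1 t).1 _ (by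
      simpa using hUO (hTU (hmemT _ _ ht)))
    rw [hk, mul_zero, zero_mul] at h1
    exact hM.ne_zero _ (le_bot_iff.1 h1)
  · exact (ENNReal.ofReal_le_ofReal (min_le_right _ _)).trans hpq.le
  · by_cases hZ : Z.Infinite
    · rwa [min_eq_left (hr.le_of_infinite μ hM hp hTo ⟨1, hT1⟩ hTc hZd hZ)]
    · have : Finite Z := Set.not_infinite.1 hZ
      have := Fintype.ofFinite Z
      rw [tsum_fintype]
      refine ENNReal.sum_ne_top.2 fun k _ => ENNReal.rpow_ne_top_of_nonneg (lt_min hr0 hp).le ?_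
      intro htop
      have h2 := ENNReal.ne_top_of_tsum_ne_top hsum k
      rw [htop, ENNReal.top_rpow_of_pos hr0] at h2
      exact h2 rfl

/-- Boundedness of the synthesis operator on the sequence space of `L^q_m`. -/
theorem exists_eLpNorm_synthesis_le {Q : Set G} (hQ : IsRelCompactNhd Q)
    (hQm : MeasurableSet Q) {M : G → ℝ≥0∞} (hM : IsLocallyModerate M) {p r : ℝ} (hp : 0 < p)
    {q : ℝ≥0∞} (hpq : ENNReal.ofReal p < q) (hr : HasRNorm (weakLp μ M p) r)
    {F : G → ℂ} (hF : Continuous F) (hFinv : ∀ x, ‖F x⁻¹‖ₑ = ‖F x‖ₑ)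
    {W : G → ℝ≥0∞} (hW : ∀ x, rightNorm μ Q (weakLp μ M p) x ≤ W x)
    (hFW : vee (amalgam μ Q (vee (amalgam μ Q (weightedLp μ W (ENNReal.ofReal r)))))
      (fun x => ‖F x‖ₑ) < ∞) {I : Type*} {X : I → G} (hX : IsRelativelySeparated X) :
    ∃ C : ℝ≥0, ∀ a : I → ℝ≥0∞, {i | a i ≠ 0}.Countable →
      eLpNorm (fun y => (∑' i, a i * control μ Q (fun x => ‖F x‖ₑ) ((X i)⁻¹ * y)) * M y) q μ ≤
        C * eLpNorm (fun i => a i * M (X i)) q (@Measure.count I ⊤) := by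
  obtain ⟨U, Z, γ, D, s, C, hUo, hUc, hcov, hγ, hDM, hD0, hs0, hs1, hsq, hsum⟩ :=
    exists_discretized_kernel μ hQ hQm hM hp hpq hr hF hFinv hW hFW
  obtain ⟨n, hn⟩ := hX.exists_encard_le hUc
  have hq0 : q ≠ 0 := (bot_le.trans_lt hpq).ne'
  set Γ := control μ Q fun x => ‖F x‖ₑ with hΓ
  set K : ℝ≥0∞ := (∑' k, (γ k * D k) ^ s) ^ (1 / s) * (n * C) with hK
  have hKt : K ≠ ∞ := ENNReal.mul_ne_top (ENNReal.rpow_ne_top_of_nonneg (by positivity) hsum)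
    (ENNReal.mul_ne_top (ENNReal.natCast_ne_top n) ENNReal.coe_ne_top)
  refine ⟨K.toNNReal, fun a ha => ?_⟩
  rw [ENNReal.coe_toNNReal hKt]
  set B := eLpNorm (fun i => a i * M (X i)) q (@Measure.count I ⊤) with hB
  have hEo : ∀ i (k : Z), MeasurableSet {y | (X i)⁻¹ * y * k ∈ U} := fun i k =>
    (hUo.preimage (by fun_prop)).measurableSet
  set h : Z → I → G → ℝ≥0∞ := fun k i y => a i * {y | (X i)⁻¹ * y * k ∈ U}.indicator M y with hh
  have hhm : ∀ k i, Measurable (h k i) := fun k i =>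
    (hM.measurable.indicator (hEo i k)).const_mul _
  set H : Z → G → ℝ≥0∞ := fun k y => γ k * (n * ⨆ i, h k i y) with hH
  have hsupm : ∀ k, Measurable fun y => ⨆ i, h k i y := by
    intro k
    have := ha.to_subtype
    have h1 : (fun y => ⨆ i, h k i y) = fun y => ⨆ i : {i | a i ≠ 0}, h k i y := by
      funext y
      refine le_antisymm (iSup_le fun i => ?_) (iSup_le fun i => le_iSup (fun i => h k i y) i)
      by_cases hi : a i = 0
      · simp [hh, hi]
      · exact le_iSup (fun i : {i | a i ≠ 0} => h k i y) ⟨i, hi⟩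
    rw [h1]
    exact Measurable.iSup fun i => hhm k i
  have hHm : ∀ k, Measurable (H k) := fun k => ((hsupm k).const_mul _).const_mul _
  have hpt : ∀ y, (∑' i, a i * Γ ((X i)⁻¹ * y)) * M y ≤ ∑' k, H k y := by
    intro y
    have hle : ∀ i, a i * Γ ((X i)⁻¹ * y) ≤
        ∑' k : Z, γ k * {i | (X i)⁻¹ * (y * k) ∈ U}.indicator a i := by
      intro i
      obtain ⟨k, hk⟩ := hcov ((X i)⁻¹ * y)
      refine le_trans ?_ (ENNReal.le_tsum k)
      rw [Set.indicator_of_mem (by simpa [mul_assoc] using hk), mul_comm]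
      gcongr
      exact hγ _ k hk
    calc (∑' i, a i * Γ ((X i)⁻¹ * y)) * M y
        ≤ (∑' i, ∑' k : Z, γ k * {i | (X i)⁻¹ * (y * k) ∈ U}.indicator a i) * M y := by
          gcongr with i
          exact hle i
      _ = ∑' k : Z, γ k * (M y * ∑' i, {i | (X i)⁻¹ * (y * k) ∈ U}.indicator a i) := by
          rw [ENNReal.tsum_comm, ← ENNReal.tsum_mul_right]
          refine tsum_congr fun k => ?_
          rw [ENNReal.tsum_mul_left]
          ring
      _ ≤ ∑' k, H k y := by
          refine ENNReal.tsum_le_tsum fun k => ?_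
          refine mul_le_mul' le_rfl ?_
          refine (mul_le_mul' le_rfl (tsum_indicator_le_mul_iSup (hn (y * k)) a)).trans ?_
          rw [mul_left_comm]
          refine mul_le_mul' le_rfl ?_
          rw [ENNReal.mul_iSup]
          refine iSup_mono fun i => ?_
          rw [ENNReal.mul_iSup]
          refine iSup_le fun hi => ?_
          simp only [hh]
          rw [Set.indicator_of_mem (by
            have : (X i)⁻¹ * (y * k) ∈ U := hi
            rwa [← mul_assoc] at this), mul_comm]
  have hHn : ∀ k, eLpNorm (H k) q μ ≤ (γ k * D k) * (n * C * B) := by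
    intro k
    have h1 : eLpNorm (fun y => ⨆ i, h k i y) q μ ≤ C * D k * B := by
      have hDt : ∀ i, eLpNorm (h k i) q μ ≤ C * D k * (a i * M (X i)) := by
        intro i
        rw [eLpNorm_ennreal_const_mul hq0 _ (hM.measurable.indicator (hEo i k))]
        refine (mul_le_mul' le_rfl (hDM (X i) k)).trans_eq ?_
        ring
      refine (eLpNorm_iSup_le (hhm k) ha (fun i hi y => ?_) hq0 hDt).trans_eq ?_
      · simp [hh, not_not.1 hi]
      · exact eLpNorm_ennreal_const_mul hq0 _ measurable_from_top
    rw [hH, eLpNorm_ennreal_const_mul hq0 _ ((hsupm k).const_mul _),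
      eLpNorm_ennreal_const_mul hq0 _ (hsupm k)]
    calc γ k * (n * eLpNorm (fun y => ⨆ i, h k i y) q μ) ≤ γ k * (n * (C * D k * B)) := by
          gcongr
      _ = _ := by ring
  have hT : {k | γ k * D k ≠ 0}.Countable := by
    refine (Summable.countable_support_ennreal hsum).mono fun k hk => ?_
    simp only [Function.mem_support, ne_eq, ENNReal.rpow_eq_zero_iff_of_pos hs0]
    exact hk
  have := hT.to_subtype
  have hHsub : ∀ y, ∑' k, H k y = ∑' k : {k | γ k * D k ≠ 0}, H k y := fun y =>
    (tsum_subtype_eq_of_support_subset (f := fun k => H k y) fun k hk => by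
      have : γ k ≠ 0 := fun h0 => hk (by simp [hH, h0])
      exact mul_ne_zero this (hD0 k)).symm
  calc eLpNorm (fun y => (∑' i, a i * Γ ((X i)⁻¹ * y)) * M y) q μ
      ≤ eLpNorm (fun y => ∑' k : {k | γ k * D k ≠ 0}, H k y) q μ :=
        eLpNorm_mono_enorm fun y => (hpt y).trans_eq (hHsub y)
    _ ≤ (∑' k : {k | γ k * D k ≠ 0}, (γ k * D k) ^ s) ^ (1 / s) * (n * C * B) :=
        eLpNorm_tsum_le_of_forall_le (g := fun k : {k | γ k * D k ≠ 0} => H k)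
          (γ := fun k : {k | γ k * D k ≠ 0} => γ k * D k) (fun k => hHm k) hs0 hs1 hsq
          fun k => hHn k
    _ ≤ (∑' k, (γ k * D k) ^ s) ^ (1 / s) * (n * C * B) := by
        gcongr
        exact ENNReal.tsum_comp_le_tsum_of_injective Subtype.val_injective _
    _ = K * B := by rw [hK]; ring

end Kernel

theorem countable_of_weak_type {I : Type*} {b : I → ℝ≥0∞} {p : ℝ} (hp : 0 < p) {S : ℝ≥0∞}
    (hS : S ≠ ∞) (hb : ∀ s : ℝ≥0∞, s * @Measure.count I ⊤ {i | s < b i} ^ (1 / p) ≤ S) :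
    {i | b i ≠ 0}.Countable := by
  let _ : MeasurableSpace I := ⊤
  have hfin : ∀ n : ℕ, {i | ((n : ℝ≥0∞)⁻¹) < b i}.Countable := by
    intro n
    rcases eq_or_ne n 0 with rfl | hn
    · simp
    refine Set.Finite.countable (Measure.count_apply_lt_top.1 ?_)
    have h1 := hb (n : ℝ≥0∞)⁻¹
    have hp' : 0 < 1 / p := one_div_pos.2 hp
    by_contra htop
    rw [not_lt, top_le_iff] at htop
    rw [htop, ENNReal.top_rpow_of_pos hp', ENNReal.mul_top (by simp)] at h1
    exact hS (top_le_iff.1 h1)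
  refine (Set.countable_iUnion hfin).mono fun i hi => ?_
  obtain ⟨n, hn⟩ := ENNReal.exists_inv_nat_lt hi
  exact Set.mem_iUnion.2 ⟨n, hn⟩

/-- Best `n`-term approximation of weak `ℓ^p` sequences in `ℓ^q`. -/
theorem exists_finset_eLpNorm_indicator_compl_le {I : Type*} {b : I → ℝ≥0∞} {p : ℝ} {q : ℝ≥0∞}
    (hp : 0 < p) (hpq : ENNReal.ofReal p < q) {S : ℝ≥0∞} (hS : S ≠ ∞)
    (hb : ∀ s : ℝ≥0∞, s * @Measure.count I ⊤ {i | s < b i} ^ (1 / p) ≤ S) {n : ℕ} (hn : 1 ≤ n) :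
    ∃ N : Finset I, N.card ≤ n ∧ eLpNorm ((N : Set I)ᶜ.indicator b) q (@Measure.count I ⊤) ≤
      weakTypeLpConst p q * S * ENNReal.ofReal ((n : ℝ) ^ (-(1 / p - (q⁻¹).toReal))) := by
  let _ : MeasurableSpace I := ⊤
  have hp' : 0 < 1 / p := one_div_pos.2 hp
  have hn0 : (n : ℝ≥0∞) ≠ 0 := by simpa using (by omega : n ≠ 0)
  have hnt : (n : ℝ≥0∞) ≠ ∞ := ENNReal.natCast_ne_top n
  rcases eq_or_ne S 0 with rfl | hS0
  · refine ⟨∅, by simp, ?_⟩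
    have : b = 0 := by
      funext i
      by_contra hi
      obtain ⟨s, hs0, hs⟩ := exists_between (pos_iff_ne_zero.2 hi)
      have h1 := hb s
      have h2 : (Measure.count {i | s < b i} : ℝ≥0∞) ≠ 0 := by
        rw [ne_eq, Measure.count_eq_zero_iff]
        exact Set.Nonempty.ne_empty ⟨i, hs⟩
      exact absurd h1 (not_le.2 (ENNReal.mul_pos hs0.ne'
        ((ENNReal.rpow_eq_zero_iff_of_pos hp').not.2 h2)))
    simp [this]
  set M : ℝ≥0∞ := S * (n : ℝ≥0∞) ^ (-(1 / p)) with hM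
  have hnp0 : (n : ℝ≥0∞) ^ (-(1 / p)) ≠ 0 := by simp [ENNReal.rpow_eq_zero_iff, hn0, hnt]
  have hnpt : (n : ℝ≥0∞) ^ (-(1 / p)) ≠ ∞ := by simp [ENNReal.rpow_eq_top_iff, hn0, hnt]
  have hM0 : M ≠ 0 := mul_ne_zero hS0 hnp0
  have hMt : M ≠ ∞ := ENNReal.mul_ne_top hS hnpt
  have hcount : (Measure.count {i | M < b i} : ℝ≥0∞) ≤ n := by
    have h1 : S * (n : ℝ≥0∞) ^ (-(1 / p)) * Measure.count {i | M < b i} ^ (1 / p) ≤ S := hb M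
    rw [mul_assoc, mul_comm, ← ENNReal.le_div_iff_mul_le (Or.inl hS0) (Or.inl hS),
      ENNReal.div_self hS0 hS, ENNReal.rpow_neg, mul_comm, ← div_eq_mul_inv] at h1
    rw [ENNReal.div_le_iff (by simp [ENNReal.rpow_eq_zero_iff, hn0])
      (ENNReal.rpow_ne_top_of_nonneg hp'.le hnt), one_mul] at h1
    exact (ENNReal.rpow_le_rpow_iff hp').1 h1
  have hfin : {i | M < b i}.Finite :=
    Measure.count_apply_lt_top.1 (hcount.trans_lt hnt.lt_top)
  obtain ⟨N, hN⟩ := hfin.exists_finset_coe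
  rw [← hN, Measure.count_apply_finset] at hcount
  refine ⟨N, by exact_mod_cast hcount, ?_⟩
  refine (eLpNorm_le_of_weak_type (μ := Measure.count) (A := S) measurable_from_top hp hpq hM0 hMt
    (fun s => ?_) fun i => ?_).trans_eq ?_
  · refine le_trans ?_ (hb s)
    refine mul_le_mul' le_rfl (ENNReal.rpow_le_rpow (measure_mono fun i hi => ?_) hp'.le)
    exact lt_of_lt_of_le hi (Set.indicator_le_self _ b i)
  · by_cases hi : i ∈ N
    · simp [hi]
    · rw [Set.indicator_of_mem (by simpa using hi)]
      by_contra h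
      have : i ∈ (N : Set I) := by
        rw [hN]
        exact not_le.1 h
      exact hi this
  · rw [hM, ENNReal.mul_rpow_of_ne_zero hS0 hnp0, ← mul_assoc (S ^ _),
      ← ENNReal.rpow_add _ _ hS0 hS, add_sub_cancel, ENNReal.rpow_one, ← ENNReal.rpow_mul,
      ← ENNReal.ofReal_rpow_of_pos (by positivity), ENNReal.ofReal_natCast, ← mul_assoc]
    congr 2
    field_simp

section Coorbit

variable {G : Type*} [Group G] [TopologicalSpace G] {H : Type*} [NormedAddCommGroup H]
  [InnerProductSpace ℂ H]

theorem inner_orbit_orbit (π : IrredUnitaryRep G H) (g : H) (x y : G) :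
    inner ℂ (π.toHom y g) (π.toHom x g) = voice π g g (x⁻¹ * y) := by
  have h : π.toHom y g = π.toHom x (π.toHom (x⁻¹ * y) g) := by
    have h' : π.toHom y = π.toHom x * π.toHom (x⁻¹ * y) := by rw [← map_mul, mul_inv_cancel_left]
    rw [h']
    rfl
  rw [h, LinearIsometryEquiv.inner_map_map, voice]

theorem enorm_voice_inv (π : IrredUnitaryRep G H) (g : H) (x : G) :
    ‖voice π g g x⁻¹‖ₑ = ‖voice π g g x‖ₑ := by
  have h := inner_orbit_orbit π g x 1
  rw [mul_one, map_one] at h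
  rw [← h, voice, ← inner_conj_symm, RCLike.enorm_conj]
  rfl

variable [MeasurableSpace G] [BorelSpace G]

/-- The voice transform of the remainder of a weak-* convergent atomic expansion. -/
theorem enorm_extVoice_sub_sum_le {μ : Measure G} {π : IrredUnitaryRep G H} {g : H} {v : G → ℝ≥0∞}
    {I : Type*} {X : I → G} {c : I → ℂ} {f : ConjFunctional μ π g v}
    (hf : ∀ h : H1 μ π g v, HasSum (fun i => c i * ofHilbert μ π g v (π.toHom (X i) g) h) (f h))
    (N : Finset I) (y : G) :
    ‖extVoice (f - ∑ i ∈ N, c i • ofHilbert μ π g v (π.toHom (X i) g)) y‖ₑ ≤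
      ∑' i, (N : Set I)ᶜ.indicator (fun i => ‖c i‖ₑ) i * ‖voice π g g ((X i)⁻¹ * y)‖ₑ := by
  classical
  unfold extVoice
  split_ifs with hy
  swap
  · simp
  have h1 := hf ⟨_, hy⟩
  have hval : ∀ i, ofHilbert μ π g v (π.toHom (X i) g) ⟨π.toHom y g, hy⟩ =
      voice π g g ((X i)⁻¹ * y) := fun i => inner_orbit_orbit π g (X i) y
  simp only [hval] at h1
  have h2 := h1.sub (hasSum_sum_of_ne_finset_zero (s := N)
    (f := (N : Set I).indicator fun i => c i * voice π g g ((X i)⁻¹ * y))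
    fun i hi => Set.indicator_of_notMem (by simpa using hi) _)
  have h3 : (f - ∑ i ∈ N, c i • ofHilbert μ π g v (π.toHom (X i) g)) ⟨π.toHom y g, hy⟩ =
      f ⟨π.toHom y g, hy⟩ -
        ∑ i ∈ N, (N : Set I).indicator (fun i => c i * voice π g g ((X i)⁻¹ * y)) i := by
    rw [LinearMap.sub_apply, LinearMap.sum_apply]
    congr 1
    refine Finset.sum_congr rfl fun i hi => ?_
    rw [Set.indicator_of_mem (by simpa using hi), LinearMap.smul_apply, hval, smul_eq_mul]
  rw [h3, ← h2.tsum_eq]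
  refine enorm_tsum_le_tsum_enorm.trans (ENNReal.tsum_le_tsum fun i => ?_)
  by_cases hi : i ∈ N
  · simp [hi]
  · simp [hi, enorm_mul]

/-- The coorbit norm of the remainder of a weak-* convergent atomic expansion is controlled by the
synthesis operator whose kernel is the control function of the voice transform. -/
theorem control_extVoice_sub_sum_le [IsTopologicalGroup G] {μ : Measure G} [μ.IsMulLeftInvariant]
    {π : IrredUnitaryRep G H} {g : H} {v : G → ℝ≥0∞} {I : Type*} {X : I → G} {c : I → ℂ}
    {f : ConjFunctional μ π g v}
    (hf : ∀ h : H1 μ π g v, HasSum (fun i => c i * ofHilbert μ π g v (π.toHom (X i) g) h) (f h))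
    (hc : {i | c i ≠ 0}.Countable) (N : Finset I) (Q : Set G) (y : G) :
    control μ Q
        (fun x => ‖extVoice (f - ∑ i ∈ N, c i • ofHilbert μ π g v (π.toHom (X i) g)) x‖ₑ) y ≤
      ∑' i, (N : Set I)ᶜ.indicator (fun i => ‖c i‖ₑ) i *
        control μ Q (fun x => ‖voice π g g x‖ₑ) ((X i)⁻¹ * y) := by
  rw [control_eq_essSup]
  refine essSup_le_of_ae_le _ ?_
  have hae : ∀ᵐ x ∂(μ.restrict Q), ∀ i ∈ {i | c i ≠ 0}, ‖voice π g g ((X i)⁻¹ * y * x)‖ₑ ≤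
      control μ Q (fun x => ‖voice π g g x‖ₑ) ((X i)⁻¹ * y) := by
    refine (ae_ball_iff hc).2 fun i _ => ?_
    rw [control_eq_essSup]
    exact ENNReal.ae_le_essSup _
  filter_upwards [hae] with x hx
  refine (enorm_extVoice_sub_sum_le hf N (y * x)).trans (ENNReal.tsum_le_tsum fun i => ?_)
  by_cases hi : c i = 0
  · have h0 : (N : Set I)ᶜ.indicator (fun i => ‖c i‖ₑ) i = 0 := by
      by_cases hiN : i ∈ N <;> simp [hiN, hi]
    rw [h0, zero_mul, zero_mul]
  · rw [← mul_assoc]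
    gcongr
    exact hx i hi

end Coorbit

end Coorbit

open Coorbit
theorem theorem7p1
    {G : Type*} [Group G] [TopologicalSpace G] [IsTopologicalGroup G] [T2Space G]
    [LocallyCompactSpace G] [MeasurableSpace G] [BorelSpace G]
    (μ : Measure G) [μ.IsHaarMeasure] [μ.Regular]
    {H : Type*} [NormedAddCommGroup H] [InnerProductSpace ℂ H] [CompleteSpace H]
    (π : IrredUnitaryRep G H)
    (Q : Set G) (hQ : IsRelCompactNhd Q) (hQm : MeasurableSet Q)
    (w m : G → ℝ) (hw : IsSubmultiplicativeWeight w) (hm : IsModerateWeight w m)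
    (p : ℝ) (hp : 0 < p) (q : ℝ≥0∞) (hpq : ENNReal.ofReal p < q)
    -- the quasi-norms of `L_m(p, ∞)` and `L^q_m`
    (Y₁ Y₂ : (G → ℝ≥0∞) → ℝ≥0∞)
    (hY₁ : Y₁ = weakLp μ (fun x => ENNReal.ofReal (m x)) p)
    (hY₂ : Y₂ = weightedLp μ (fun x => ENNReal.ofReal (m x)) q)
    -- the control weight of the common reservoir of the two coorbit spaces
    (v : G → ℝ≥0∞) (hv : v = fun x => max (weightV μ Q Y₁ x) (weightV μ Q Y₂ x))
    (r : ℝ) (hr : HasRNorm Y₁ r)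
    {I : Type*} (X : I → G) (hX : IsWellSpread X)
    (g : H) (hg0 : g ≠ 0) (hg : g ∈ analyzingVectors μ π Q Y₁ r)
    (h₁ : IsAtomicDecomposition μ π g v Q Y₁ X)
    (h₂ : IsAtomicDecomposition μ π g v Q Y₂ X) :
    ∃ C : ℝ≥0, ∀ f ∈ coorbit μ π g v Q Y₁, ∀ n : ℕ, 1 ≤ n →
      bestNTermError Q Y₂ X n f ≤
        C * coorbitNorm Q Y₁ f * ENNReal.ofReal ((n : ℝ) ^ (-(1 / p - (q⁻¹).toReal))) := by
  subst hY₁ hY₂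
  have hM := hm.isLocallyModerate hw
  set M : G → ℝ≥0∞ := fun x => ENNReal.ofReal (m x) with hMdef
  obtain ⟨l, -, hexp, -, -, c₀, C₀, hc₀, hequiv⟩ := h₁
  obtain ⟨C₁, -, hC₁⟩ := exists_weak_type_le_seqNorm μ hM hp hX.1 hQ
  obtain ⟨C₂, hC₂⟩ := exists_eLpNorm_synthesis_le μ hQ hQm hM hp hpq hr
    (continuous_voice π g g) (enorm_voice_inv π g) (fun x => le_max_left _ _) hg.2.2 hX.1
  have hc₀' : (c₀ : ℝ≥0∞) ≠ 0 := by simpa using hc₀.ne'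
  have hWt := weakTypeLpConst_ne_top hp hpq
  set K : ℝ≥0∞ := C₂ * (weakTypeLpConst p q * (C₁ / c₀)) with hK
  have hKt : K ≠ ∞ := ENNReal.mul_ne_top ENNReal.coe_ne_top
    (ENNReal.mul_ne_top hWt (ENNReal.div_ne_top ENNReal.coe_ne_top hc₀'))
  refine ⟨K.toNNReal, fun f hf n hn => ?_⟩
  rw [ENNReal.coe_toNNReal hKt]
  set c : I → ℂ := fun i => l i ⟨f, hf.1⟩ with hc
  set R : ℝ≥0∞ := coorbitNorm Q (weakLp μ M p) f with hR
  have hRt : R ≠ ∞ := hf.2.2.ne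
  set S : ℝ≥0∞ := C₁ / c₀ * R with hS
  have hSt : S ≠ ∞ := ENNReal.mul_ne_top (ENNReal.div_ne_top ENNReal.coe_ne_top hc₀') hRt
  have hweak : ∀ s : ℝ≥0∞,
      s * @Measure.count I ⊤ {i | s < ‖c i‖ₑ * M (X i)} ^ (1 / p) ≤ S := by
    intro s
    refine (hC₁ c s).trans ?_
    have h1 := (hequiv ⟨f, hf.1⟩ hf).1
    rw [mul_comm, ← ENNReal.le_div_iff_mul_le (Or.inl hc₀') (Or.inl (by simp))] at h1
    refine (mul_le_mul' le_rfl h1).trans_eq ?_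
    simp only [hS, hR, div_eq_mul_inv]
    ring
  have hcount : {i | c i ≠ 0}.Countable := countable_of_weak_type hp hSt hweak |>.mono fun i hi =>
    mul_ne_zero (by simpa using hi) (hM.ne_zero _)
  obtain ⟨N, hNn, hN⟩ := exists_finset_eLpNorm_indicator_compl_le hp hpq hSt hweak hn
  have hind : (fun i => (N : Set I)ᶜ.indicator (fun i => ‖c i‖ₑ) i * M (X i)) =
      (N : Set I)ᶜ.indicator fun i => ‖c i‖ₑ * M (X i) := by
    funext i
    by_cases hi : i ∈ N <;> simp [hi]
  calc bestNTermError Q (weightedLp μ M q) X n f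
      ≤ coorbitNorm Q (weightedLp μ M q)
          (f - ∑ i ∈ N, c i • ofHilbert μ π g v (π.toHom (X i) g)) :=
        iInf_le_of_le N (iInf₂_le_of_le hNn c le_rfl)
    _ ≤ eLpNorm (fun y => (∑' i, (N : Set I)ᶜ.indicator (fun i => ‖c i‖ₑ) i *
          control μ Q (fun x => ‖voice π g g x‖ₑ) ((X i)⁻¹ * y)) * M y) q μ := by
        refine eLpNorm_mono_enorm fun y => ?_
        exact mul_le_mul' (control_extVoice_sub_sum_le (hexp ⟨f, hf.1⟩ hf) hcount N Q y) le_rfl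
    _ ≤ C₂ * eLpNorm (fun i => (N : Set I)ᶜ.indicator (fun i => ‖c i‖ₑ) i * M (X i)) q
          (@Measure.count I ⊤) := hC₂ _ (hcount.mono fun i hi => by
            contrapose! hi
            have h0 : c i = 0 := by simpa using hi
            by_cases hiN : i ∈ N <;> simp [hiN, h0])
    _ ≤ C₂ * (weakTypeLpConst p q * S *
          ENNReal.ofReal ((n : ℝ) ^ (-(1 / p - (q⁻¹).toReal)))) := by
        rw [hind]
        gcongr
    _ = K * R * ENNReal.ofReal ((n : ℝ) ^ (-(1 / p - (q⁻¹).toReal))) := by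
        rw [hK, hS]
        ring
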